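/- Let $c>0$ and let $\mathcal A=L^2(\mathbb R^d)\cap L^\infty(\mathbb R^d)$ (complex-valued functions, pointwise product, involution $f\mapsto\bar f$, scalar product $\langle f,g\rangle=\int_{\mathbb R^d}\bar f g$). The algebra RSWN of the renormalized square of white noise is the $*$-Lie algebra with central element $1$ and generators $B^+_f,B_f,N_f$ ($f\in\mathcal A$; $B^+_f$ and $N_f$ linear in $f$), with $(B^+_f)^*=B_f$, $N_f^*=N_{\bar f}$, $[B_f,B^+_g]=2c\langle f,g\rangle+4N_{\bar fg}$, $[N_a,B^+_f]=2B^+_{af}$ and $[B^+_f,B^+_g]=[B_f,B_g]=[N_a,N_{a'}]=0$. The quadratic Fock space $\Gamma_2(\mathcal A)$, with vacuum vector $\Phi$, is the GNS Hilbert space of the state $\varphi$ on the universal enveloping algebra $U(\mathrm{RSWN})$ (the central element being identified with the unit) such that $\varphi(1)=1$ and $\varphi(xB_g)=\varphi(xN_g)=0$ for all $x\in U(\mathrm{RSWN})$, $g\in\mathcal A$. For $f\in\mathcal A$ the quadratic exponential vector is $\Psi(f)=\sum_{n\ge 0}\frac{1}{n!}(B^+_f)^n\Phi$, whenever this series converges.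 Let $T:\mathcal A\to\mathcal A$ be linear. One says that the quadratic second quantization $\Gamma_2(T)$ exists if $\Psi(Tf)$ exists whenever $\Psi(f)$ exists and there is a linear operator $\Gamma_2(T)$ on the linear span of all quadratic exponential vectors with $\Gamma_2(T)\Psi(f)=\Psi(Tf)$; it is called unitary if it extends to a unitary operator on $\Gamma_2(\mathcal A)$. A $*$-endomorphism of the Hilbert algebra $\mathcal A$ is a linear map $T_1:\mathcal A\to\mathcal A$ with $T_1(fg)=T_1(f)T_1(g)$, $T_1(\bar f)=\overline{T_1(f)}$ and $\langle T_1f,T_1g\rangle=\langle f,g\rangle$ for all $f,g\in\mathcal A$; it is a $*$-automorphism if moreover $T_1(\mathcal A)=\mathcal A$. **Theorem.** (i) $\Gamma_2(T)$ exists and is an isometry if and only if there are a Borel function $\alpha:\mathbb R^d\to\mathbb R$ and a $*$-endomorphism $T_1$ of $\mathcal A$ such that $T=e^{i\alpha}T_1$, i.e. $Tf=e^{i\alpha}\,T_1f$ almost everywhere for all $f\in\mathcal A$. (ii) $\Gamma_2(T)$ exists and is unitary if and only if there are a Borel function $\alpha:\mathbb R^d\to\mathbb R$ and a $*$-automorphism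 $T_1$ of $\mathcal A$ such that $T=e^{i\alpha}T_1$. -/

import Mathlib

open MeasureTheory
open scoped NNReal ENNReal ComplexConjugate

noncomputable section

namespace QuadraticFock

/-! ### The test function algebra `L²(ℝᵈ) ∩ L^∞(ℝᵈ)` -/

/-- The space `L²(ℝᵈ) ∩ L^∞(ℝᵈ)` of classes (modulo a.e. equality) of complex functions,
as a subspace of the space of all classes of measurable functions. -/
def testSubmodule (d : ℕ) :
    Submodule ℂ (EuclideanSpace ℝ (Fin d) →ₘ[volume] ℂ) where
  carrier := {f | MemLp f 2 volume ∧ MemLp f ∞ volume}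
  zero_mem' := by
    constructor
    · exact (memLp_congr_ae AEEqFun.coeFn_zero).2 MemLp.zero
    · exact (memLp_congr_ae AEEqFun.coeFn_zero).2 MemLp.zero
  add_mem' {f g} hf hg :=
    ⟨(memLp_congr_ae (AEEqFun.coeFn_add f g)).2 (hf.1.add hg.1),
      (memLp_congr_ae (AEEqFun.coeFn_add f g)).2 (hf.2.add hg.2)⟩
  smul_mem' z f hf :=
    ⟨(memLp_congr_ae (AEEqFun.coeFn_smul z f)).2 (hf.1.const_smul z),
      (memLp_congr_ae (AEEqFun.coeFn_smul z f)).2 (hf.2.const_smul z)⟩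

/-- The test function algebra `L²(ℝᵈ) ∩ L^∞(ℝᵈ)`. -/
def TestAlgebra (d : ℕ) : Type := testSubmodule d

namespace TestAlgebra

variable {d : ℕ}

instance : AddCommGroup (TestAlgebra d) := inferInstanceAs (AddCommGroup (testSubmodule d))

instance : Module ℂ (TestAlgebra d) := inferInstanceAs (Module ℂ (testSubmodule d))

/-- The class modulo a.e. equality underlying a test function. -/
def toAEEqFun (f : TestAlgebra d) : EuclideanSpace ℝ (Fin d) →ₘ[volume] ℂ := f.1

/-- A representative of a test function. -/
instance : CoeFun (TestAlgebra d) (fun _ => EuclideanSpace ℝ (Fin d) → ℂ) :=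
  ⟨fun f => f.toAEEqFun⟩

theorem memLp_two (f : TestAlgebra d) : MemLp (f : EuclideanSpace ℝ (Fin d) → ℂ) 2 volume := f.2.1

theorem memLp_top (f : TestAlgebra d) : MemLp (f : EuclideanSpace ℝ (Fin d) → ℂ) ∞ volume := f.2.2

theorem ext {f g : TestAlgebra d}
    (h : (f : EuclideanSpace ℝ (Fin d) → ℂ) =ᵐ[volume] g) : f = g :=
  Subtype.ext (AEEqFun.ext h)

/-- Pointwise (a.e.) multiplication. -/
instance : Mul (TestAlgebra d) :=
  ⟨fun f g => ⟨f.toAEEqFun * g.toAEEqFun,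
    (memLp_congr_ae (AEEqFun.coeFn_mul _ _)).2 (g.memLp_two.mul f.memLp_top),
    (memLp_congr_ae (AEEqFun.coeFn_mul _ _)).2 (g.memLp_top.mul f.memLp_top)⟩⟩

/-- Pointwise (a.e.) complex conjugation. -/
instance : Star (TestAlgebra d) :=
  ⟨fun f => ⟨star f.toAEEqFun,
    (memLp_congr_ae (AEEqFun.coeFn_star _)).2 f.memLp_two.star,
    (memLp_congr_ae (AEEqFun.coeFn_star _)).2 f.memLp_top.star⟩⟩

theorem coe_add (f g : TestAlgebra d) : ⇑(f + g).toAEEqFun =ᵐ[volume] fun x => f x + g x :=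
  AEEqFun.coeFn_add _ _

theorem coe_smul (z : ℂ) (f : TestAlgebra d) : ⇑(z • f).toAEEqFun =ᵐ[volume] fun x => z * f x :=
  AEEqFun.coeFn_smul _ _

theorem coe_zero : ⇑(0 : TestAlgebra d).toAEEqFun =ᵐ[volume] fun _ => 0 :=
  AEEqFun.coeFn_zero

theorem coe_mul (f g : TestAlgebra d) : ⇑(f * g).toAEEqFun =ᵐ[volume] fun x => f x * g x :=
  AEEqFun.coeFn_mul _ _

theorem coe_star (f : TestAlgebra d) :
    ⇑(star f).toAEEqFun =ᵐ[volume] fun x => conj (f x) :=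
  AEEqFun.coeFn_star _

instance : NonUnitalCommRing (TestAlgebra d) where
  left_distrib a b c := by
    apply ext
    filter_upwards [coe_mul a (b + c), coe_add b c, coe_add (a * b) (a * c), coe_mul a b,
      coe_mul a c] with x h1 h2 h3 h4 h5
    rw [h1, h2, h3, h4, h5, mul_add]
  right_distrib a b c := by
    apply ext
    filter_upwards [coe_mul (a + b) c, coe_add a b, coe_add (a * c) (b * c), coe_mul a c,
      coe_mul b c] with x h1 h2 h3 h4 h5
    rw [h1, h2, h3, h4, h5, add_mul]
  zero_mul a := by
    apply ext
    filter_upwards [coe_mul 0 a, coe_zero (d := d)] with x h1 h2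
    rw [h1, h2, zero_mul]
  mul_zero a := by
    apply ext
    filter_upwards [coe_mul a 0, coe_zero (d := d)] with x h1 h2
    rw [h1, h2, mul_zero]
  mul_assoc a b c := by
    apply ext
    filter_upwards [coe_mul (a * b) c, coe_mul a b, coe_mul a (b * c), coe_mul b c]
      with x h1 h2 h3 h4
    rw [h1, h2, h3, h4, mul_assoc]
  mul_comm a b := by
    apply ext
    filter_upwards [coe_mul a b, coe_mul b a] with x h1 h2
    rw [h1, h2, mul_comm]

instance : IsScalarTower ℂ (TestAlgebra d) (TestAlgebra d) where
  smul_assoc z a b := by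
    apply ext
    simp only [smul_eq_mul]
    filter_upwards [coe_mul (z • a) b, coe_smul z a, coe_smul z (a * b), coe_mul a b]
      with x h1 h2 h3 h4
    rw [h1, h2, h3, h4, mul_assoc]

instance : SMulCommClass ℂ (TestAlgebra d) (TestAlgebra d) where
  smul_comm z a b := by
    apply ext
    simp only [smul_eq_mul]
    filter_upwards [coe_mul a (z • b), coe_smul z b, coe_smul z (a * b), coe_mul a b]
      with x h1 h2 h3 h4
    rw [h1, h2, h3, h4, mul_left_comm]

instance : StarRing (TestAlgebra d) where
  star_involutive a := by
    apply ext
    filter_upwards [coe_star (star a), coe_star a] with x h1 h2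
    rw [h1, h2, Complex.conj_conj]
  star_mul a b := by
    apply ext
    filter_upwards [coe_star (a * b), coe_mul a b, coe_mul (star b) (star a), coe_star a,
      coe_star b] with x h1 h2 h3 h4 h5
    rw [h1, h2, h3, h4, h5, map_mul, mul_comm]
  star_add a b := by
    apply ext
    filter_upwards [coe_star (a + b), coe_add a b, coe_add (star a) (star b), coe_star a,
      coe_star b] with x h1 h2 h3 h4 h5
    rw [h1, h2, h3, h4, h5, map_add]

instance : StarModule ℂ (TestAlgebra d) where
  star_smul z a := by
    apply ext
    filter_upwards [coe_star (z • a), coe_smul z a, coe_smul (star z) (star a), coe_star a]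
      with x h1 h2 h3 h4
    rw [h1, h2, h3, h4, map_mul]
    rfl

theorem integrable_mul (f g : TestAlgebra d) : Integrable (fun x => f x * g x) :=
  MemLp.integrable_mul f.memLp_two g.memLp_two

/-- The bilinear form `(f, g) ↦ ∫ f(s) g(s) ds`. -/
def pairing : TestAlgebra d →ₗ[ℂ] TestAlgebra d →ₗ[ℂ] ℂ :=
  LinearMap.mk₂ ℂ (fun f g => ∫ x, f x * g x)
    (fun f f' g => by
      rw [← integral_add (integrable_mul f g) (integrable_mul f' g)]
      apply integral_congr_ae
      filter_upwards [coe_add f f'] with x h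
      rw [h, add_mul])
    (fun z f g => by
      rw [smul_eq_mul, ← integral_const_mul]
      apply integral_congr_ae
      filter_upwards [coe_smul z f] with x h
      rw [h, mul_assoc])
    (fun f g g' => by
      rw [← integral_add (integrable_mul f g) (integrable_mul f g')]
      apply integral_congr_ae
      filter_upwards [coe_add g g'] with x h
      rw [h, mul_add])
    (fun z f g => by
      rw [smul_eq_mul, ← integral_const_mul]
      apply integral_congr_ae
      filter_upwards [coe_smul z g] with x h
      rw [h, mul_left_comm])

/-- The scalar product `⟨f, g⟩ = ∫ \bar f(s) g(s) ds` of `L²(ℝᵈ)`. -/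
def scalar (f g : TestAlgebra d) : ℂ := ∫ x, conj (f x) * g x

theorem pairing_apply (f g : TestAlgebra d) : pairing f g = ∫ x, f x * g x := rfl

theorem pairing_star (f g : TestAlgebra d) : pairing (star f) g = scalar f g := by
  rw [pairing_apply, scalar]
  apply integral_congr_ae
  filter_upwards [coe_star f] with x h
  rw [h]

theorem pairing_comm (f g : TestAlgebra d) : pairing f g = pairing g f := by
  simp only [pairing_apply, mul_comm]

theorem pairing_mul (f g h : TestAlgebra d) : pairing f (g * h) = pairing (f * g) h := by
  simp only [pairing_apply]
  apply integral_congr_ae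
  filter_upwards [coe_mul f g, coe_mul g h] with x h1 h2
  rw [h1, h2, mul_assoc]

theorem star_pairing (f g : TestAlgebra d) :
    star (pairing f g) = pairing (star f) (star g) := by
  simp only [pairing_apply, RCLike.star_def, ← integral_conj]
  apply integral_congr_ae
  filter_upwards [coe_star f, coe_star g] with x h1 h2
  rw [h1, h2, map_mul]

theorem pairing_star_self_nonneg (f : TestAlgebra d) :
    ∃ r : ℝ, 0 ≤ r ∧ pairing (star f) f = r := by
  refine ⟨∫ x, ‖f x‖ ^ 2, integral_nonneg fun _ => by positivity, ?_⟩
  rw [pairing_star, scalar, ← integral_complex_ofReal]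
  congr 1
  ext x
  rw [Complex.conj_mul', Complex.ofReal_pow]

end TestAlgebra

/-! ### The algebra of the renormalized square of white noise -/

/-- The Lie algebra of the renormalized square of white noise: the quadruple `(p, q, n, z)`
stands for `B⁺_p + B_{\bar q} + N_n + z • 1`.  (The symbol `B_f` is conjugate-linear in `f`, so
that `q ↦ B_{\bar q}` is linear.) -/
@[ext]
structure RSWN (c : ℝ≥0) (d : ℕ) where
  /-- the coefficient of the creation part -/
  p : TestAlgebra d
  /-- the coefficient of the annihilation part -/
  q : TestAlgebra d
  /-- the coefficient of the number part -/
  n : TestAlgebra d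
  /-- the coefficient of the central part -/
  z : ℂ

namespace RSWN

variable {c : ℝ≥0} {d : ℕ}

/-- The four coefficients of an element. -/
def equivProd : RSWN c d ≃ TestAlgebra d × TestAlgebra d × TestAlgebra d × ℂ where
  toFun x := (x.p, x.q, x.n, x.z)
  invFun y := ⟨y.1, y.2.1, y.2.2.1, y.2.2.2⟩

instance : AddCommGroup (RSWN c d) := equivProd.addCommGroup

instance : Module ℂ (RSWN c d) := equivProd.module ℂ

@[simp] theorem add_p (x y : RSWN c d) : (x + y).p = x.p + y.p := rfl
@[simp] theorem add_q (x y : RSWN c d) : (x + y).q = x.q + y.q := rfl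
@[simp] theorem add_n (x y : RSWN c d) : (x + y).n = x.n + y.n := rfl
@[simp] theorem add_z (x y : RSWN c d) : (x + y).z = x.z + y.z := rfl
@[simp] theorem smul_p (a : ℂ) (x : RSWN c d) : (a • x).p = a • x.p := rfl
@[simp] theorem smul_q (a : ℂ) (x : RSWN c d) : (a • x).q = a • x.q := rfl
@[simp] theorem smul_n (a : ℂ) (x : RSWN c d) : (a • x).n = a • x.n := rfl
@[simp] theorem smul_z (a : ℂ) (x : RSWN c d) : (a • x).z = a * x.z := rfl
@[simp] theorem zero_p : (0 : RSWN c d).p = 0 := rfl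
@[simp] theorem zero_q : (0 : RSWN c d).q = 0 := rfl
@[simp] theorem zero_n : (0 : RSWN c d).n = 0 := rfl
@[simp] theorem zero_z : (0 : RSWN c d).z = 0 := rfl

/-- The creation generator `B⁺_f`. -/
def creation (f : TestAlgebra d) : RSWN c d := ⟨f, 0, 0, 0⟩

/-- The annihilation generator `B_f`. -/
def annihilation (f : TestAlgebra d) : RSWN c d := ⟨0, star f, 0, 0⟩

/-- The number generator `N_f`. -/
def number (f : TestAlgebra d) : RSWN c d := ⟨0, 0, f, 0⟩

/-- The central element `1`. -/
def central : RSWN c d := ⟨0, 0, 0, 1⟩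

/-- The Lie bracket, written in coefficients; the lemmas `lie_annihilation_creation`, …,
`lie_central` below are the commutation relations of the generators. -/
instance : Bracket (RSWN c d) (RSWN c d) where
  bracket x y :=
    { p := (2 : ℂ) • (x.n * y.p - y.n * x.p)
      q := (2 : ℂ) • (y.n * x.q - x.n * y.q)
      n := (4 : ℂ) • (x.q * y.p - y.q * x.p)
      z := 2 * (c : ℂ) * (TestAlgebra.pairing x.q y.p - TestAlgebra.pairing y.q x.p) }

@[simp] theorem lie_p (x y : RSWN c d) : ⁅x, y⁆.p = (2 : ℂ) • (x.n * y.p - y.n * x.p) := rfl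
@[simp] theorem lie_q (x y : RSWN c d) : ⁅x, y⁆.q = (2 : ℂ) • (y.n * x.q - x.n * y.q) := rfl
@[simp] theorem lie_n (x y : RSWN c d) : ⁅x, y⁆.n = (4 : ℂ) • (x.q * y.p - y.q * x.p) := rfl
@[simp] theorem lie_z (x y : RSWN c d) : ⁅x, y⁆.z =
    2 * (c : ℂ) * (TestAlgebra.pairing x.q y.p - TestAlgebra.pairing y.q x.p) := rfl

instance : LieRing (RSWN c d) where
  add_lie x y z := by
    ext1 <;> simp only [lie_p, lie_q, lie_n, lie_z, add_p, add_q, add_n, add_z, add_mul, mul_add,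
      map_add, LinearMap.add_apply] <;> first | module | ring
  lie_add x y z := by
    ext1 <;> simp only [lie_p, lie_q, lie_n, lie_z, add_p, add_q, add_n, add_z, add_mul, mul_add,
      map_add, LinearMap.add_apply] <;> first | module | ring
  lie_self x := by
    ext1 <;> simp
  leibniz_lie x y z := by
    have e : ∀ f g h : TestAlgebra d, TestAlgebra.pairing f (g * h) =
        TestAlgebra.pairing (g * f) h := fun f g h => by
      rw [TestAlgebra.pairing_mul, mul_comm]
    ext1
    on_goal 4 =>
      simp only [lie_p, lie_q, lie_z, add_z, map_sub, map_smul, LinearMap.sub_apply,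
        LinearMap.smul_apply, smul_eq_mul, e]
      ring
    all_goals
      simp only [lie_p, lie_q, lie_n, add_p, add_q, add_n, mul_sub, sub_mul,
        mul_smul_comm, smul_mul_assoc, mul_assoc]
      simp only [mul_comm, mul_left_comm]
      module

instance : LieAlgebra ℂ (RSWN c d) where
  lie_smul a x y := by
    ext1 <;> simp only [lie_p, lie_q, lie_n, lie_z, smul_p, smul_q, smul_n, smul_z,
      mul_smul_comm, smul_mul_assoc, map_smul, LinearMap.smul_apply, smul_eq_mul] <;>
      first | module | ring

/-- The involution: `(B⁺_f)* = B_f`, `(B_f)* = B⁺_f`, `(N_f)* = N_{\bar f}`, `1* = 1`. -/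
instance : Star (RSWN c d) :=
  ⟨fun x => ⟨star x.q, star x.p, star x.n, conj x.z⟩⟩

@[simp] theorem star_p (x : RSWN c d) : (star x).p = star x.q := rfl
@[simp] theorem star_q (x : RSWN c d) : (star x).q = star x.p := rfl
@[simp] theorem star_n (x : RSWN c d) : (star x).n = star x.n := rfl
@[simp] theorem star_z (x : RSWN c d) : (star x).z = conj x.z := rfl

theorem star_creation (f : TestAlgebra d) :
    star (creation f : RSWN c d) = annihilation f := by
  ext1 <;> simp [creation, annihilation]

theorem star_annihilation (f : TestAlgebra d) :
    star (annihilation f : RSWN c d) = creation f := by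
  ext1 <;> simp [creation, annihilation]

theorem star_number (f : TestAlgebra d) :
    star (number f : RSWN c d) = number (star f) := by
  ext1 <;> simp [number]

theorem star_central : star (central : RSWN c d) = central := by
  ext1 <;> simp [central]

theorem star_add (x y : RSWN c d) : star (x + y) = star x + star y := by
  ext1 <;> simp

theorem star_smul (a : ℂ) (x : RSWN c d) : star (a • x) = conj a • star x := by
  ext1 <;> simp

theorem star_star (x : RSWN c d) : star (star x) = x := by
  ext1 <;> simp

theorem star_lie (x y : RSWN c d) : star ⁅x, y⁆ = ⁅star y, star x⁆ := by
  have e : ∀ f g : TestAlgebra d, conj (TestAlgebra.pairing f g) =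
      TestAlgebra.pairing (star g) (star f) := fun f g => by
    rw [← RCLike.star_def, TestAlgebra.star_pairing, TestAlgebra.pairing_comm]
  ext1 <;> simp [e, mul_comm]
  exact Or.inl (Or.inl (map_ofNat _ 2))

theorem lie_annihilation_creation (f g : TestAlgebra d) :
    ⁅(annihilation f : RSWN c d), (creation g : RSWN c d)⁆ =
      (2 * (c : ℂ) * TestAlgebra.scalar f g) • central + (4 : ℂ) • number (star f * g) := by
  ext1 <;> simp [creation, annihilation, central, number, TestAlgebra.pairing_star]

theorem lie_number_creation (a f : TestAlgebra d) :
    ⁅(number a : RSWN c d), (creation f : RSWN c d)⁆ = (2 : ℂ) • creation (a * f) := by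
  ext1 <;> simp [creation, number]

theorem lie_creation_creation (f g : TestAlgebra d) :
    ⁅(creation f : RSWN c d), (creation g : RSWN c d)⁆ = 0 := by
  ext1 <;> simp [creation]

theorem lie_annihilation_annihilation (f g : TestAlgebra d) :
    ⁅(annihilation f : RSWN c d), (annihilation g : RSWN c d)⁆ = 0 := by
  ext1 <;> simp [annihilation]

theorem lie_number_number (a b : TestAlgebra d) :
    ⁅(number a : RSWN c d), (number b : RSWN c d)⁆ = 0 := by
  ext1 <;> simp [number]

theorem lie_central (x : RSWN c d) : ⁅(central : RSWN c d), x⁆ = 0 := by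
  ext1 <;> simp [central]

end RSWN

/-! ### The vacuum module

The quadratic Fock state is obtained from the representation of the Lie algebra on the symmetric
algebra of `L² ∩ L^∞`, in which `B⁺_f` is multiplication by `f`, and `B_f`, `N_f` kill `1`. -/

/-- The space of polynomials in the creation operators applied to the vacuum. -/
abbrev VacuumModule (d : ℕ) : Type := SymmetricAlgebra ℂ (TestAlgebra d)

namespace VacuumModule

variable {d : ℕ}

/-- The generators of the symmetric algebra. -/
def gen : TestAlgebra d →ₗ[ℂ] VacuumModule d := SymmetricAlgebra.ι ℂ (TestAlgebra d)

theorem induct {P : VacuumModule d → Prop} (one : P 1)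
    (gen_mul : ∀ p v, P v → P (gen p * v)) (add : ∀ v w, P v → P w → P (v + w))
    (smul : ∀ (a : ℂ) v, P v → P (a • v)) (v : VacuumModule d) : P v := by
  suffices h : ∀ a v : VacuumModule d, P v → P (a * v) by simpa using h v 1 one
  intro a
  induction a using SymmetricAlgebra.induction with
  | algebraMap r => intro v hv; rw [← Algebra.smul_def]; exact smul r v hv
  | ι x => intro v hv; exact gen_mul x v hv
  | mul a b ha hb => intro v hv; rw [mul_assoc]; exact ha _ (hb _ hv)
  | add a b ha hb => intro v hv; rw [add_mul]; exact add _ _ (ha _ hv) (hb _ hv)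

/-- A linear map with commuting values in a (noncommutative) algebra extends to the symmetric
algebra. -/
def liftCommute {R : Type*} [Ring R] [Algebra ℂ R] (f : TestAlgebra d →ₗ[ℂ] R)
    (hf : ∀ p q, f p * f q = f q * f p) : VacuumModule d →ₐ[ℂ] R :=
  RingCon.liftₐ _ (TensorAlgebra.lift ℂ f) <| by
    rw [TensorAlgebra.symRingCon, RingCon.ringConGen_le]
    intro a b h
    induction h with | mul_comm x y
    rw [RingCon.ker_apply, map_mul, map_mul]
    simpa using hf x y

theorem liftCommute_gen {R : Type*} [Ring R] [Algebra ℂ R] (f : TestAlgebra d →ₗ[ℂ] R)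
    (hf : ∀ p q, f p * f q = f q * f p) (p : TestAlgebra d) :
    liftCommute f hf (gen p) = f p :=
  TensorAlgebra.lift_ι_apply f p

/-- The operators used to extend prescribed commutators with the generators. -/
def stepOp (δ : TestAlgebra d →ₗ[ℂ] Module.End ℂ (VacuumModule d)) :
    TestAlgebra d →ₗ[ℂ] Module.End ℂ (VacuumModule d × VacuumModule d) where
  toFun p :=
    LinearMap.prod ((LinearMap.mulLeft ℂ (gen p)).comp (LinearMap.fst ℂ _ _))
      ((LinearMap.mulLeft ℂ (gen p)).comp (LinearMap.snd ℂ _ _) +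
        (δ p).comp (LinearMap.fst ℂ _ _))
  map_add' p q := by
    ext x <;> simp [add_mul]
  map_smul' a p := by
    ext x <;> simp

theorem stepOp_apply (δ : TestAlgebra d →ₗ[ℂ] Module.End ℂ (VacuumModule d))
    (p : TestAlgebra d) (x : VacuumModule d × VacuumModule d) :
    stepOp δ p x = (gen p * x.1, gen p * x.2 + δ p x.1) := rfl

/-- The operator `D` with `D 1 = 0` and `[D, p] = δ_p` for all generators `p`. -/
def extend (δ : TestAlgebra d →ₗ[ℂ] Module.End ℂ (VacuumModule d))
    (hδ : ∀ p q v, gen p * δ q v + δ p (gen q * v) = gen q * δ p v + δ q (gen p * v)) :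
    Module.End ℂ (VacuumModule d) where
  toFun v := (liftCommute (stepOp δ) (fun p q => by
    refine LinearMap.ext fun x => ?_
    simp only [Module.End.mul_apply, stepOp_apply, Prod.mk.injEq]
    refine ⟨mul_left_comm _ _ _, ?_⟩
    have := hδ p q x.1
    rw [mul_add, mul_add, add_assoc, add_assoc, this, mul_left_comm]) v (1, 0)).2
  map_add' v w := by simp
  map_smul' a v := by simp

section extend

variable (δ : TestAlgebra d →ₗ[ℂ] Module.End ℂ (VacuumModule d))
  (hδ : ∀ p q v, gen p * δ q v + δ p (gen q * v) = gen q * δ p v + δ q (gen p * v))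

theorem extend_one : extend δ hδ 1 = 0 := by
  simp [extend]

theorem extend_gen_mul (p : TestAlgebra d) (v : VacuumModule d) :
    extend δ hδ (gen p * v) = gen p * extend δ hδ v + δ p v := by
  have key : ∀ (h : ∀ p q, stepOp δ p * stepOp δ q = stepOp δ q * stepOp δ p)
      (w : VacuumModule d), (liftCommute (stepOp δ) h w (1, 0)).1 = w := by
    intro h w
    induction w using induct with
    | one => simp
    | gen_mul p v hv =>
      rw [map_mul, liftCommute_gen, Module.End.mul_apply, stepOp_apply, hv]
    | add v w hv hw => simp [hv, hw]
    | smul a v hv => simp [hv]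
  change (liftCommute (stepOp δ) _ (gen p * v) (1, 0)).2 = _
  rw [map_mul, liftCommute_gen, Module.End.mul_apply, stepOp_apply, key]
  rfl

end extend

theorem end_ext {D E : Module.End ℂ (VacuumModule d)} (h1 : D 1 = E 1)
    (h : ∀ p v, D v = E v → D (gen p * v) = E (gen p * v)) : D = E := by
  refine LinearMap.ext fun v => ?_
  induction v using induct with
  | one => exact h1
  | gen_mul p v hv => exact h p v hv
  | add v w hv hw => rw [map_add, map_add, hv, hw]
  | smul a v hv => rw [map_smul, map_smul, hv]

/-- The operator `N_a` on the vacuum module. -/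
def num (a : TestAlgebra d) : Module.End ℂ (VacuumModule d) :=
  extend
    { toFun := fun p => LinearMap.mulLeft ℂ (gen ((2 : ℂ) • (a * p)))
      map_add' := fun p q => by ext v; simp [mul_add, add_mul]
      map_smul' := fun z p => by
        refine LinearMap.ext fun v => ?_
        simp only [mul_smul_comm, map_smul, LinearMap.mulLeft_apply, smul_mul_assoc,
          RingHom.id_apply, LinearMap.smul_apply]
        exact smul_comm _ _ _ }
    (fun p q v => by
      simp only [LinearMap.coe_mk, AddHom.coe_mk, LinearMap.mulLeft_apply]
      ring)

@[simp] theorem num_one (a : TestAlgebra d) : num a 1 = 0 := extend_one _ _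

@[simp] theorem num_gen_mul (a p : TestAlgebra d) (v : VacuumModule d) :
    num a (gen p * v) = gen p * num a v + (2 : ℂ) • (gen (a * p) * v) := by
  rw [num, extend_gen_mul]
  simp

theorem num_add (a b : TestAlgebra d) : num (a + b) = num a + num b := by
  apply end_ext
  · simp
  · intro p v h
    simp only [LinearMap.add_apply, num_gen_mul] at h ⊢
    rw [h, add_mul, map_add]
    simp only [add_mul, mul_add]
    module

theorem num_smul (z : ℂ) (a : TestAlgebra d) : num (z • a) = z • num a := by
  apply end_ext
  · simp
  · intro p v h
    simp only [LinearMap.smul_apply, num_gen_mul] at h ⊢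
    rw [h, smul_mul_assoc, map_smul]
    simp only [smul_mul_assoc, mul_smul_comm]
    module

variable (c : ℝ≥0)

/-- The operator `B_{\bar q}` on the vacuum module. -/
def ann (q : TestAlgebra d) : Module.End ℂ (VacuumModule d) :=
  extend
    { toFun := fun p => (2 * (c : ℂ) * TestAlgebra.pairing q p) • 1 + (4 : ℂ) • num (q * p)
      map_add' := fun p p' => by
        rw [mul_add, num_add, map_add]
        module
      map_smul' := fun z p => by
        rw [mul_smul_comm, num_smul, map_smul]
        simp only [smul_eq_mul, RingHom.id_apply]
        module }
    (fun p p' v => by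
      simp only [LinearMap.coe_mk, AddHom.coe_mk, LinearMap.add_apply, LinearMap.smul_apply,
        Module.End.one_apply, num_gen_mul, mul_add, mul_smul_comm, mul_assoc, smul_add]
      rw [mul_comm p p']
      module)

@[simp] theorem ann_one (q : TestAlgebra d) : ann c q 1 = 0 := extend_one _ _

@[simp] theorem ann_gen_mul (q p : TestAlgebra d) (v : VacuumModule d) :
    ann c q (gen p * v) = gen p * ann c q v +
      ((2 * (c : ℂ) * TestAlgebra.pairing q p) • v + (4 : ℂ) • num (q * p) v) := by
  rw [ann, extend_gen_mul]
  rfl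

theorem ann_add (a b : TestAlgebra d) : ann c (a + b) = ann c a + ann c b := by
  apply end_ext
  · simp
  · intro p v h
    simp only [LinearMap.add_apply, ann_gen_mul] at h ⊢
    rw [h, add_mul, map_add, num_add, LinearMap.add_apply, LinearMap.add_apply]
    simp only [mul_add]
    module

theorem ann_smul (z : ℂ) (a : TestAlgebra d) : ann c (z • a) = z • ann c a := by
  apply end_ext
  · simp
  · intro p v h
    simp only [LinearMap.smul_apply, ann_gen_mul] at h ⊢
    rw [h, smul_mul_assoc, map_smul, num_smul, LinearMap.smul_apply, LinearMap.smul_apply]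
    simp only [mul_smul_comm, smul_eq_mul]
    module

theorem num_num (a b : TestAlgebra d) (v : VacuumModule d) :
    num a (num b v) = num b (num a v) := by
  refine LinearMap.congr_fun (f := num a * num b) (g := num b * num a) ?_ v
  apply end_ext
  · simp
  · intro p v h
    simp only [Module.End.mul_apply, num_gen_mul, map_add, map_smul] at h ⊢
    rw [h, mul_left_comm a b p]
    module

theorem num_ann (a q : TestAlgebra d) (v : VacuumModule d) :
    num a (ann c q v) = ann c q (num a v) - (2 : ℂ) • ann c (a * q) v := by
  refine LinearMap.congr_fun (f := num a * ann c q)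
    (g := ann c q * num a - (2 : ℂ) • ann c (a * q)) ?_ v
  apply end_ext
  · simp
  · intro p v h
    have e : TestAlgebra.pairing (a * q) p = TestAlgebra.pairing q (a * p) := by
      rw [TestAlgebra.pairing_mul, mul_comm]
    simp only [Module.End.mul_apply, num_gen_mul, ann_gen_mul, map_add, map_smul,
      LinearMap.sub_apply, LinearMap.smul_apply] at h ⊢
    rw [h, num_num a (q * p), e, mul_assoc a q p, mul_left_comm a q p]
    simp only [mul_sub, mul_smul_comm]
    module

theorem ann_ann (q r : TestAlgebra d) (v : VacuumModule d) :
    ann c q (ann c r v) = ann c r (ann c q v) := by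
  refine LinearMap.congr_fun (f := ann c q * ann c r) (g := ann c r * ann c q) ?_ v
  apply end_ext
  · simp
  · intro p v h
    simp only [Module.End.mul_apply, ann_gen_mul, map_add, map_smul] at h ⊢
    rw [h, num_ann, num_ann]
    have e : r * p * q = q * p * r := by rw [mul_comm, mul_comm r p, mul_assoc]
    rw [e]
    module

/-- The representation of the Lie algebra on the vacuum module, as a linear map. -/
def act : RSWN c d →ₗ[ℂ] Module.End ℂ (VacuumModule d) where
  toFun x := LinearMap.mulLeft ℂ (gen x.p) + ann c x.q + num x.n + x.z • 1
  map_add' x y := by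
    ext v
    simp [ann_add, num_add, add_mul]
    module
  map_smul' a x := by
    ext v
    simp [ann_smul, num_smul]
    module

theorem act_apply (x : RSWN c d) (v : VacuumModule d) :
    act c x v = gen x.p * v + ann c x.q v + num x.n v + x.z • v := rfl

theorem act_lie (x y : RSWN c d) (v : VacuumModule d) :
    act c ⁅x, y⁆ v = act c x (act c y v) - act c y (act c x v) := by
  have n3 : ∀ a b : TestAlgebra d, num (a - b) = num a - num b := fun a b => by
    rw [sub_eq_add_neg, ← neg_one_smul ℂ b, num_add, num_smul]
    module
  have a3 : ∀ a b : TestAlgebra d, ann c (a - b) = ann c a - ann c b := fun a b => by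
    rw [sub_eq_add_neg, ← neg_one_smul ℂ b, ann_add, ann_smul]
    module
  simp only [act_apply, RSWN.lie_p, RSWN.lie_q, RSWN.lie_n, RSWN.lie_z, map_add, map_smul,
    map_sub, ann_gen_mul, num_gen_mul, num_ann, ann_smul, num_smul, n3, a3, LinearMap.smul_apply,
    LinearMap.sub_apply, sub_mul, smul_mul_assoc]
  rw [ann_ann c x.q y.q, num_num x.n y.n, mul_left_comm (gen x.p)]
  module

end VacuumModule

/-! ### The quadratic Fock state -/

section State

attribute [local instance 100] LieRing.ofAssociativeRing

variable (c : ℝ≥0) (d : ℕ)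

/-- The universal enveloping algebra `U(RSWN)`. -/
abbrev Enveloping : Type := UniversalEnvelopingAlgebra ℂ (RSWN c d)

/-- The inclusion of the generators into the universal enveloping algebra. -/
def inU : RSWN c d →ₗ[ℂ] Enveloping c d :=
  (UniversalEnvelopingAlgebra.ι ℂ : RSWN c d →ₗ⁅ℂ⁆ Enveloping c d).toLinearMap

/-- The representation of `U(RSWN)` on the vacuum module. -/
def vacuumRep : Enveloping c d →ₐ[ℂ] Module.End ℂ (VacuumModule d) :=
  UniversalEnvelopingAlgebra.lift ℂ
    { VacuumModule.act c with
      map_lie' := fun {x y} => LinearMap.ext fun v => VacuumModule.act_lie c x y v }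

/-- The quadratic Fock state `φ`: the coefficient of the vacuum `1` in `x · 1`.  It is the state
characterized by `φ(1) = 1` and `φ(x B_f) = φ(x N_f) = 0`, the central element of the Lie algebra
being identified with the unit; these properties, and positivity, are proved below. -/
def fockState : Enveloping c d →ₗ[ℂ] ℂ where
  toFun x := SymmetricAlgebra.algebraMapInv (vacuumRep c d x 1)
  map_add' x y := by simp
  map_smul' a x := by simp

variable {c d}

theorem vacuumRep_inU (x : RSWN c d) : vacuumRep c d (inU c d x) = VacuumModule.act c x :=
  UniversalEnvelopingAlgebra.lift_ι_apply ℂ _ x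

theorem inU_lie (x y : RSWN c d) :
    inU c d ⁅x, y⁆ = inU c d x * inU c d y - inU c d y * inU c d x :=
  LieHom.map_lie (UniversalEnvelopingAlgebra.ι ℂ) x y

theorem fockState_one : fockState c d 1 = 1 := by
  simp [fockState]

theorem fockState_mul_annihilation (x : Enveloping c d) (f : TestAlgebra d) :
    fockState c d (x * inU c d (RSWN.annihilation f)) = 0 := by
  simp [fockState, vacuumRep_inU, VacuumModule.act_apply, RSWN.annihilation,
    show VacuumModule.num (0 : TestAlgebra d) = 0 by simpa using VacuumModule.num_smul 0 0]

theorem fockState_mul_number (x : Enveloping c d) (f : TestAlgebra d) :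
    fockState c d (x * inU c d (RSWN.number f)) = 0 := by
  simp [fockState, vacuumRep_inU, VacuumModule.act_apply, RSWN.number,
    show VacuumModule.ann c (0 : TestAlgebra d) = 0 by simpa using VacuumModule.ann_smul c 0 0]

theorem fockState_mul_central (x : Enveloping c d) :
    fockState c d (x * inU c d RSWN.central) = fockState c d x := by
  simp [fockState, vacuumRep_inU, VacuumModule.act_apply, RSWN.central]

/-- An algebra with the conjugate scalar multiplication. -/
def ConjAlg (R : Type*) : Type _ := R

instance {R : Type*} [Ring R] : Ring (ConjAlg R) := inferInstanceAs (Ring R)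

instance {R : Type*} [Ring R] [Algebra ℂ R] : Algebra ℂ (ConjAlg R) where
  smul a r := (show ConjAlg R from (conj a • (show R from r) : R))
  algebraMap := ((algebraMap ℂ R).comp (starRingEnd ℂ) : ℂ →+* R)
  commutes' a r := Algebra.commutes (A := R) (conj a) r
  smul_def' a r := Algebra.smul_def (A := R) (conj a) r

theorem ConjAlg.smul_eq {R : Type*} [Ring R] [Algebra ℂ R] (a : ℂ) (r : R) :
    (a • (show ConjAlg R from r) : ConjAlg R) = (conj a • r : R) := rfl

variable (c d)

/-- The involution of `U(RSWN)` as an algebra homomorphism to the conjugate opposite algebra. -/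
def starHom : Enveloping c d →ₐ[ℂ] ConjAlg (Enveloping c d)ᵐᵒᵖ :=
  UniversalEnvelopingAlgebra.lift ℂ
    { toFun := fun x => (MulOpposite.op (inU c d (star x)) : (Enveloping c d)ᵐᵒᵖ)
      map_add' := fun x y => by rw [RSWN.star_add, map_add]; rfl
      map_smul' := fun a x => by rw [RSWN.star_smul, map_smul]; rfl
      map_lie' := fun {x y} => by
        rw [RSWN.star_lie, inU_lie]
        rfl }

/-- The involution of `U(RSWN)`: the conjugate-linear anti-multiplicative map that extends the
involution of the Lie algebra. -/
instance : Star (Enveloping c d) :=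
  ⟨fun x => MulOpposite.unop (show (Enveloping c d)ᵐᵒᵖ from starHom c d x)⟩

variable {c d}

theorem star_inU (x : RSWN c d) : star (inU c d x) = inU c d (star x) :=
  congrArg (fun y : (Enveloping c d)ᵐᵒᵖ => MulOpposite.unop y)
    (UniversalEnvelopingAlgebra.lift_ι_apply ℂ _ x :
      starHom c d (inU c d x) = (MulOpposite.op (inU c d (star x)) : (Enveloping c d)ᵐᵒᵖ))

theorem star_mul_U (x y : Enveloping c d) : star (x * y) = star y * star x :=
  congrArg (fun y : (Enveloping c d)ᵐᵒᵖ => MulOpposite.unop y) (map_mul (starHom c d) x y)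

theorem star_add_U (x y : Enveloping c d) : star (x + y) = star x + star y :=
  congrArg (fun y : (Enveloping c d)ᵐᵒᵖ => MulOpposite.unop y) (map_add (starHom c d) x y)

theorem star_one_U : star (1 : Enveloping c d) = 1 :=
  congrArg (fun y : (Enveloping c d)ᵐᵒᵖ => MulOpposite.unop y) (map_one (starHom c d))

theorem star_smul_U (a : ℂ) (x : Enveloping c d) : star (a • x) = conj a • star x :=
  congrArg (fun y : (Enveloping c d)ᵐᵒᵖ => MulOpposite.unop y) (map_smul (starHom c d) a x)

end State

/-! ### Positivity of the quadratic Fock state -/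

namespace VacuumModule

variable {d : ℕ}

/-- The coefficient of the vacuum. -/
def vac (d : ℕ) : VacuumModule d →ₐ[ℂ] ℂ := SymmetricAlgebra.algebraMapInv

@[simp] theorem vac_gen (p : TestAlgebra d) : vac d (gen p) = 0 :=
  SymmetricAlgebra.algebraMapInv_ι p

theorem vac_num (a : TestAlgebra d) (v : VacuumModule d) : vac d (num a v) = 0 := by
  induction v using induct with
  | one => simp
  | gen_mul p v hv => simp
  | add v w hv hw => simp [hv, hw]
  | smul z v hv => simp [hv]

variable (c : ℝ≥0)

/-- The product of the adjoints of the creation operators in a polynomial. -/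
def adj : VacuumModule d →ₐ[ℂ] ConjAlg (Module.End ℂ (VacuumModule d)) :=
  liftCommute
    { toFun := fun p => (ann c (star p) : Module.End ℂ (VacuumModule d))
      map_add' := fun p q => by rw [star_add, ann_add]; rfl
      map_smul' := fun a p => by rw [star_smul, ann_smul]; rfl }
    (fun p q => LinearMap.ext fun v => ann_ann c (star p) (star q) v)

/-- The sesquilinear form of the vacuum module. -/
def form : VacuumModule d →ₗ⋆[ℂ] VacuumModule d →ₗ[ℂ] ℂ :=
  LinearMap.mk₂'ₛₗ (starRingEnd ℂ) (RingHom.id ℂ)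
    (fun u v => vac d ((show Module.End ℂ (VacuumModule d) from adj c u) v))
    (fun u u' v => by
      rw [map_add]
      exact map_add (vac d) _ _)
    (fun a u v => by
      rw [map_smul]
      exact map_smul (vac d) (conj a) _)
    (fun u v v' => by rw [map_add, map_add])
    (fun a u v => by rw [map_smul, map_smul]; rfl)

theorem form_one (v : VacuumModule d) : form c 1 v = vac d v := by
  change vac d ((show Module.End ℂ (VacuumModule d) from adj c 1) v) = _
  rw [map_one]
  rfl

theorem form_gen_mul (p : TestAlgebra d) (u v : VacuumModule d) :
    form c (gen p * u) v = form c u (ann c (star p) v) := by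
  have h : adj c (gen p * u) =
      (adj c u * (show ConjAlg (Module.End ℂ (VacuumModule d)) from ann c (star p))) := by
    rw [mul_comm, map_mul]
    congr 1
    exact liftCommute_gen _ _ p
  change vac d ((show Module.End ℂ (VacuumModule d) from adj c (gen p * u)) v) = _
  rw [h]
  rfl

theorem form_num (a : TestAlgebra d) (u v : VacuumModule d) :
    form c (num a u) v = form c u (num (star a) v) := by
  induction u using induct generalizing v with
  | one => rw [form_one, vac_num]; simp
  | gen_mul p u hu =>
    rw [num_gen_mul, map_add, map_smulₛₗ, LinearMap.add_apply, LinearMap.smul_apply,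
      form_gen_mul, form_gen_mul, form_gen_mul, hu, num_ann, map_sub, map_smul, star_mul',
      map_ofNat]
    abel
  | add v w hv hw => simp [hv, hw]
  | smul z v hv => simp [hv]

theorem num_pow (a g : TestAlgebra d) (n : ℕ) :
    num a (gen g ^ (n + 1)) = (2 * (n + 1) : ℂ) • (gen (a * g) * gen g ^ n) := by
  induction n with
  | zero => have := num_gen_mul a g 1; simpa using this
  | succ n ih =>
    rw [pow_succ', num_gen_mul, ih, mul_smul_comm, pow_succ', mul_left_comm (gen g)]
    push_cast
    module

theorem ann_pow (q g : TestAlgebra d) (n : ℕ) :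
    ann c q (gen g ^ (n + 1)) =
      (2 * (c : ℂ) * (n + 1) * TestAlgebra.pairing q g) • gen g ^ n +
        (4 * (n + 1) * n : ℂ) • (gen (q * g * g) * gen g ^ (n - 1)) := by
  induction n with
  | zero => have := ann_gen_mul c q g 1; simpa using this
  | succ n ih =>
    rw [pow_succ', ann_gen_mul, ih, num_pow]
    rcases n with _ | n
    · simp
      module
    · simp only [Nat.add_sub_cancel, mul_add, mul_smul_comm, mul_left_comm (gen g),
        ← pow_succ']
      push_cast
      module

theorem ann_pow_gen_mul (q p : TestAlgebra d) (n : ℕ) (v : VacuumModule d) :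
    (ann c q ^ (n + 1)) (gen p * v) = gen p * (ann c q ^ (n + 1)) v +
      (2 * (c : ℂ) * (n + 1) * TestAlgebra.pairing q p) • (ann c q ^ n) v +
      (4 * (n + 1) : ℂ) • num (q * p) ((ann c q ^ n) v) +
      (4 * (n + 1) * n : ℂ) • ann c (q * p * q) ((ann c q ^ (n - 1)) v) := by
  induction n with
  | zero =>
    simp
    module
  | succ n ih =>
    have comm : ∀ w, ann c q (num (q * p) w) =
        num (q * p) (ann c q w) + (2 : ℂ) • ann c (q * p * q) w := fun w => by
      rw [num_ann]; abel
    rw [pow_succ' (ann c q) (n + 1), Module.End.mul_apply, ih]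
    simp only [map_add, map_smul, ann_gen_mul, comm]
    rw [ann_ann c q (q * p * q)]
    rcases n with _ | n
    · simp
      module
    · simp only [Nat.add_sub_cancel, ← Module.End.mul_apply, ← pow_succ']
      simp only [Module.End.mul_apply]
      push_cast
      module

theorem vac_ann_pow_gen_mul (q p : TestAlgebra d) (n : ℕ) (v : VacuumModule d) :
    vac d ((ann c q ^ (n + 1)) (gen p * v)) =
      2 * (c : ℂ) * (n + 1) * TestAlgebra.pairing q p * vac d ((ann c q ^ n) v) +
      4 * (n + 1) * n * vac d ((ann c q ^ (n - 1)) (ann c (q * p * q) v)) := by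
  have comm : ∀ (k : ℕ) w, ann c (q * p * q) ((ann c q ^ k) w) =
      (ann c q ^ k) (ann c (q * p * q) w) := fun k w => by
    induction k generalizing w with
    | zero => rfl
    | succ k ih => rw [pow_succ, Module.End.mul_apply, Module.End.mul_apply, ih, ann_ann]
  rw [ann_pow_gen_mul, comm]
  simp only [map_add, map_smul, map_mul, vac_gen, vac_num, smul_eq_mul]
  ring

theorem vac_two_step (q g p : TestAlgebra d) (n m : ℕ) :
    vac d ((ann c q ^ (n + 1)) (gen p * gen g ^ (m + 1))) =
      2 * (c : ℂ) * (n + 1) * TestAlgebra.pairing q p * vac d ((ann c q ^ n) (gen g ^ (m + 1))) +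
      4 * (n + 1) * n * (2 * (c : ℂ) * (m + 1) * TestAlgebra.pairing q (q * g * p) *
        vac d ((ann c q ^ (n - 1)) (gen g ^ m))) +
      4 * (n + 1) * n * (4 * (m + 1) * m *
        vac d ((ann c q ^ (n - 1)) (gen (q * g * (q * g * p)) * gen g ^ (m - 1)))) := by
  have e : TestAlgebra.pairing (q * p * q) g = TestAlgebra.pairing q (q * g * p) := by
    rw [TestAlgebra.pairing_comm, TestAlgebra.pairing_mul, TestAlgebra.pairing_comm]
    congr 1
    simp only [mul_comm, mul_left_comm]
  have e2 : q * p * q * g * g = q * g * (q * g * p) := by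
    simp only [mul_comm, mul_left_comm]
  rw [vac_ann_pow_gen_mul, ann_pow, e, e2]
  simp only [map_add, map_smul, smul_eq_mul]
  ring

theorem vac_zero_step (q p : TestAlgebra d) (n : ℕ) :
    vac d ((ann c q ^ (n + 1)) (gen p)) =
      2 * (c : ℂ) * (n + 1) * TestAlgebra.pairing q p * vac d ((ann c q ^ n) 1) := by
  have := vac_ann_pow_gen_mul c q p n 1
  simpa using this

/-- Recursion formula for the scalar products of powers of creation operators. -/
theorem recursion (n m : ℕ) : ∃ a : ℕ → ℝ, (∀ k, 0 ≤ a k) ∧ (∀ k, m < k → a k = 0) ∧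
    ∀ q g p : TestAlgebra d, vac d ((ann c q ^ (n + 1)) (gen p * gen g ^ m)) =
      ∑ k ∈ Finset.range (n + 1), (a k : ℂ) *
        TestAlgebra.pairing q ((fun x => q * g * x)^[k] p) *
        vac d ((ann c q ^ (n - k)) (gen g ^ (m - k))) := by
  induction n using Nat.strong_induction_on generalizing m with
  | _ n ih =>
  rcases m with _ | m
  · refine ⟨fun k => if k = 0 then 2 * c * (n + 1) else 0,
      fun k => by dsimp; split_ifs <;> positivity, fun k hk => if_neg (by omega),
      fun q g p => ?_⟩
    rw [pow_zero, mul_one, vac_zero_step, Finset.sum_eq_single 0]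
    · simp
    · intro k _ hk
      simp [hk]
    · simp
  rcases n with _ | _ | n
  · refine ⟨fun k => if k = 0 then 2 * c else 0, fun k => by dsimp; split_ifs <;> positivity,
      fun k hk => if_neg (by omega), fun q g p => ?_⟩
    rw [vac_two_step]
    simp
  · refine ⟨fun k => if k = 0 then 4 * c else if k = 1 then 16 * c * (m + 1) else 0,
      fun k => by dsimp; split_ifs <;> positivity, fun k hk => ?_, fun q g p => ?_⟩
    · dsimp only
      rw [if_neg (by omega), if_neg (by omega)]
    · rw [vac_two_step]
      simp [Finset.sum_range_succ]
      ring
  · have : ∃ a : ℕ → ℝ, (∀ k, 0 ≤ a k) ∧ (∀ k, m < k + 1 → m * a k = 0) ∧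
        ∀ q g p : TestAlgebra d,
          m * vac d ((ann c q ^ (n + 1)) (gen p * gen g ^ (m - 1))) =
          m * ∑ k ∈ Finset.range (n + 1), (a k : ℂ) *
            TestAlgebra.pairing q ((fun x => q * g * x)^[k] p) *
            vac d ((ann c q ^ (n - k)) (gen g ^ (m - 1 - k))) := by
      obtain ⟨a, ha, ha0, h⟩ := ih n (by omega) (m - 1)
      refine ⟨a, ha, fun k hk => ?_, fun q g p => by rw [h]⟩
      rcases m with _ | m
      · simp
      · rw [ha0 k (by omega), mul_zero]
    obtain ⟨a, ha, ha0, h⟩ := this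
    refine ⟨fun k => if k = 0 then 2 * c * (n + 3) else if k = 1 then
        4 * (n + 3) * (n + 2) * (2 * c * (m + 1)) else
        4 * (n + 3) * (n + 2) * (4 * (m + 1)) * (m * a (k - 2)),
      fun k => ?_, fun k hk => ?_, fun q g p => ?_⟩
    · have := ha (k - 2)
      dsimp
      split_ifs <;> positivity
    · dsimp only
      rw [if_neg (by omega), if_neg (by omega), ha0 _ (by omega), mul_zero]
    · have h' := h q g (q * g * (q * g * p))
      rw [vac_two_step, Finset.sum_range_succ', Finset.sum_range_succ',
        show n + 1 + 1 - 1 = n + 1 by omega, mul_assoc (4 * ((m : ℂ) + 1)) (m : ℂ), h',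
        Finset.mul_sum, Finset.mul_sum, Finset.mul_sum]
      have key : ∀ k ∈ Finset.range (n + 1),
          4 * (((n + 1 + 1 : ℕ) : ℂ) + 1) * ((n + 1 + 1 : ℕ) : ℂ) * (4 * ((m : ℂ) + 1) * ((m : ℂ) *
          ((a k : ℂ) * TestAlgebra.pairing q ((fun x => q * g * x)^[k] (q * g * (q * g * p))) *
            vac d ((ann c q ^ (n - k)) (gen g ^ (m - 1 - k)))))) =
          (((if k + 1 + 1 = 0 then 2 * c * (n + 3) else if k + 1 + 1 = 1 then
            4 * (n + 3) * (n + 2) * (2 * c * (m + 1)) else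
            4 * (n + 3) * (n + 2) * (4 * (m + 1)) * (m * a (k + 1 + 1 - 2)) : ℝ)) : ℂ) *
          TestAlgebra.pairing q ((fun x => q * g * x)^[k + 1 + 1] p) *
          vac d ((ann c q ^ (n + 1 + 1 - (k + 1 + 1))) (gen g ^ (m + 1 - (k + 1 + 1)))) := by
        intro k _
        rw [if_neg (by omega), if_neg (by omega), Function.iterate_succ_apply,
          Function.iterate_succ_apply, show k + 1 + 1 - 2 = k by omega,
          show n + 1 + 1 - (k + 1 + 1) = n - k by omega,
          show m + 1 - (k + 1 + 1) = m - 1 - k by omega]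
        push_cast
        ring
      rw [Finset.sum_congr rfl key]
      simp
      ring

theorem vac_ann_pow_ne (q g : TestAlgebra d) (n m : ℕ) (h : n ≠ m) :
    vac d ((ann c q ^ n) (gen g ^ m)) = 0 := by
  induction n using Nat.strong_induction_on generalizing m with
  | _ n ih =>
  rcases n with _ | n
  · rcases m with _ | m
    · exact absurd rfl h
    · simp
  rcases m with _ | m
  · rw [pow_zero, pow_succ, Module.End.mul_apply, ann_one, map_zero, map_zero]
  obtain ⟨a, -, ha0, hr⟩ := recursion (d := d) c n m
  rw [pow_succ' (gen g), hr]
  refine Finset.sum_eq_zero fun k hk => ?_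
  rw [Finset.mem_range] at hk
  rcases lt_or_ge m k with hm | hm
  · simp [ha0 k hm]
  · rw [ih (n - k) (by omega) (m - k) (by omega), mul_zero]

/-- The matrix of scalar products of the `n`-th powers of creation operators. -/
def gramPow (d n : ℕ) : Matrix (TestAlgebra d) (TestAlgebra d) ℂ :=
  Matrix.of fun f g => vac d ((ann c (star f) ^ n) (gen g ^ n))

open scoped ComplexOrder

theorem posSemidef_pairing (h : TestAlgebra d → TestAlgebra d) :
    (Matrix.of fun f g => TestAlgebra.pairing (star (h f)) (h g) :
      Matrix (TestAlgebra d) (TestAlgebra d) ℂ).PosSemidef := by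
  constructor
  · ext f g
    simp only [Matrix.conjTranspose_apply, Matrix.of_apply]
    rw [TestAlgebra.star_pairing, star_star, TestAlgebra.pairing_comm]
  · intro x
    obtain ⟨r, hr, h2⟩ := TestAlgebra.pairing_star_self_nonneg (x.sum fun f a => a • h f)
    have : (x.sum fun i xi => x.sum fun j xj => star xi *
        (Matrix.of fun f g => TestAlgebra.pairing (star (h f)) (h g) :
          Matrix (TestAlgebra d) (TestAlgebra d) ℂ) i j * xj) = r := by
      rw [← h2]
      simp only [Finsupp.sum, star_sum, map_sum, LinearMap.sum_apply, star_smul, map_smul,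
        LinearMap.smul_apply, smul_eq_mul, Matrix.of_apply]
      rw [Finset.sum_comm]
      refine Finset.sum_congr rfl fun i _ => ?_
      try rw [Finset.mul_sum]
      refine Finset.sum_congr rfl fun j _ => ?_
      ring
    rw [this]
    exact Complex.zero_le_real.2 hr

theorem pairing_iterate (f g : TestAlgebra d) (k : ℕ) :
    TestAlgebra.pairing (star f) ((fun x => star f * g * x)^[k] g) =
      TestAlgebra.pairing (star ((fun x => f * x)^[k] f)) ((fun x => g * x)^[k] g) := by
  have h : ∀ (k : ℕ) (u v : TestAlgebra d),
      TestAlgebra.pairing u ((fun x => star f * x)^[k] v) =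
        TestAlgebra.pairing ((fun x => star f * x)^[k] u) v := by
    intro k
    induction k with
    | zero => intro u v; rfl
    | succ k ih =>
      intro u v
      rw [Function.iterate_succ_apply', Function.iterate_succ_apply, TestAlgebra.pairing_mul, ih,
        mul_comm u]
  have h1 : (fun x => star f * g * x) = (fun x => star f * x) ∘ (fun x => g * x) := by
    funext x
    exact mul_assoc _ _ _
  have h3 : Function.Commute (fun x => star f * x) (fun x => g * x) := fun x =>
    mul_left_comm _ _ _
  have h2 : ∀ k : ℕ, star ((fun x => f * x)^[k] f) = (fun x => star f * x)^[k] (star f) := by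
    intro k
    induction k with
    | zero => rfl
    | succ k ih =>
      rw [Function.iterate_succ_apply', Function.iterate_succ_apply', star_mul', ih]
  rw [h1, h3.comp_iterate, Function.comp_apply, h, h2]

theorem posSemidef_gramPow (n : ℕ) : (gramPow c d n).PosSemidef := by
  induction n using Nat.strong_induction_on with
  | _ n ih =>
  rcases n with _ | n
  · constructor
    · ext f g
      simp [gramPow]
    · intro x
      have : (x.sum fun i xi => x.sum fun j xj => star xi * gramPow c d 0 i j * xj) =
          star (x.sum fun _ a => a) * (x.sum fun _ a => a) := by
        simp [gramPow, Finsupp.sum, Finset.sum_mul_sum]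
      rw [this]
      exact star_mul_self_nonneg _
  · obtain ⟨a, ha, -, hr⟩ := recursion (d := d) c n n
    have : gramPow c d (n + 1) = ∑ k ∈ Finset.range (n + 1), a k •
        Matrix.hadamard (Matrix.of fun f g => TestAlgebra.pairing (star ((fun x => f * x)^[k] f))
          ((fun x => g * x)^[k] g)) (gramPow c d (n - k)) := by
      ext f g
      rw [gramPow, Matrix.of_apply, pow_succ' (gen g), hr, Matrix.sum_apply]
      refine Finset.sum_congr rfl fun k _ => ?_
      rw [pairing_iterate, Matrix.smul_apply, Matrix.hadamard_apply, Matrix.of_apply, gramPow,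
        Matrix.of_apply, Complex.real_smul, mul_assoc]
    rw [this]
    refine Matrix.posSemidef_sum _ fun k hk => Matrix.PosSemidef.smul ?_ (ha k)
    exact (posSemidef_pairing fun f => (fun x => f * x)^[k] f).hadamard (ih _ (by omega))

theorem form_pow (n m : ℕ) (f g : TestAlgebra d) :
    form c (gen f ^ n) (gen g ^ m) = if n = m then gramPow c d n f g else 0 := by
  have h : ∀ (n : ℕ) (v : VacuumModule d),
      form c (gen f ^ n) v = vac d ((ann c (star f) ^ n) v) := by
    intro n
    induction n with
    | zero => intro v; rw [pow_zero, form_one]; rfl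
    | succ n ih => intro v; rw [pow_succ', form_gen_mul, ih, pow_succ]; rfl
  rw [h]
  split_ifs with hnm
  · subst hnm; rfl
  · exact vac_ann_pow_ne c _ _ _ _ hnm

/-- Polarization: the powers of the generators span the symmetric algebra. -/
theorem span_pow :
    Submodule.span ℂ (Set.range fun i : ℕ × TestAlgebra d => gen i.2 ^ i.1) = ⊤ := by
  set W := Submodule.span ℂ (Set.range fun i : ℕ × TestAlgebra d => gen i.2 ^ i.1) with hW
  have hmem : ∀ (n : ℕ) (f : TestAlgebra d), gen f ^ n ∈ W := fun n f =>
    Submodule.subset_span ⟨(n, f), rfl⟩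
  have key : ∀ (p g : TestAlgebra d) (n : ℕ), gen p * gen g ^ n ∈ W := by
    intro p g n
    by_contra hcon
    obtain ⟨ℓ, hℓ, hker⟩ := Submodule.exists_le_ker_of_notMem hcon
    let P : Polynomial ℂ := ∑ m ∈ Finset.range (n + 1 + 1),
      Polynomial.C (ℓ (gen p ^ m * gen g ^ (n + 1 - m) * ((n + 1).choose m : VacuumModule d))) *
        Polynomial.X ^ m
    have hP : P = 0 := by
      refine Polynomial.funext fun t => ?_
      have h1 : ℓ (gen (t • p + g) ^ (n + 1)) = 0 := hker (hmem _ _)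
      rw [map_add, map_smul, add_pow, map_sum] at h1
      rw [Polynomial.eval_zero, ← h1, Polynomial.eval_finsetSum]
      refine Finset.sum_congr rfl fun m _ => ?_
      rw [smul_pow, smul_mul_assoc, smul_mul_assoc, map_smul]
      rw [Polynomial.eval_mul, Polynomial.eval_C, Polynomial.eval_pow, Polynomial.eval_X,
        smul_eq_mul, mul_comm]
    have h1 : P.coeff 1 = 0 := by rw [hP]; simp
    rw [Polynomial.finsetSum_coeff, Finset.sum_eq_single 1] at h1
    · rw [Polynomial.coeff_C_mul, Polynomial.coeff_X_pow_self, mul_one, pow_one,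
        Nat.add_sub_cancel, Nat.choose_one_right, mul_comm, ← nsmul_eq_mul, map_nsmul] at h1
      rcases smul_eq_zero.1 h1 with h | h
      · omega
      · exact hℓ h
    · intro m _ hm
      rw [Polynomial.coeff_C_mul, Polynomial.coeff_X_pow, if_neg (Ne.symm hm), mul_zero]
    · simp
  refine Submodule.eq_top_iff'.2 fun v => ?_
  induction v using induct with
  | one => simpa using hmem 0 0
  | gen_mul p v hv =>
    induction hv using Submodule.span_induction with
    | mem x hx => obtain ⟨i, rfl⟩ := hx; exact key _ _ _
    | zero => simp
    | add x y _ _ hx hy => rw [mul_add]; exact W.add_mem hx hy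
    | smul a x _ hx => rw [mul_smul_comm]; exact W.smul_mem a hx
  | add v w hv hw => exact W.add_mem hv hw
  | smul a v hv => exact W.smul_mem a hv

theorem form_conj (u v : VacuumModule d) : conj (form c v u) = form c u v := by
  have hu : u ∈ Submodule.span ℂ (Set.range fun i : ℕ × TestAlgebra d => gen i.2 ^ i.1) := by
    rw [span_pow]; trivial
  have hv : v ∈ Submodule.span ℂ (Set.range fun i : ℕ × TestAlgebra d => gen i.2 ^ i.1) := by
    rw [span_pow]; trivial
  induction hu using Submodule.span_induction with
  | zero => simp
  | add x y _ _ hx hy => simp [hx, hy]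
  | smul a x _ hx => simp [hx]
  | mem x hx =>
    obtain ⟨⟨n, f⟩, rfl⟩ := hx
    induction hv using Submodule.span_induction with
    | zero => simp
    | add x y _ _ hx hy => simp only [map_add, LinearMap.add_apply, hx, hy]
    | smul a x _ hx => simp only [map_smulₛₗ, LinearMap.smul_apply, smul_eq_mul, map_mul, hx,
        Complex.conj_conj, RingHom.id_apply]
    | mem y hy =>
      obtain ⟨⟨m, g⟩, rfl⟩ := hy
      rw [form_pow, form_pow]
      by_cases h : m = n
      · subst h
        rw [if_pos rfl, if_pos rfl]
        exact (posSemidef_gramPow c m).1.apply f g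
      · rw [if_neg h, if_neg (Ne.symm h), map_zero]

theorem form_nonneg (v : VacuumModule d) : 0 ≤ form c v v := by
  let W : ℕ → Submodule ℂ (VacuumModule d) := fun n =>
    Submodule.span ℂ (Set.range fun f : TestAlgebra d => gen f ^ n)
  have hW : v ∈ ⨆ n, W n := by
    have : (⊤ : Submodule ℂ (VacuumModule d)) ≤ ⨆ n, W n := by
      rw [← span_pow, Submodule.span_le]
      rintro _ ⟨⟨n, f⟩, rfl⟩
      exact Submodule.mem_iSup_of_mem n (Submodule.subset_span ⟨f, rfl⟩)
    exact this trivial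
  have hdiag : ∀ n, ∀ w ∈ W n, 0 ≤ form c w w := by
    intro n w hw
    obtain ⟨x, rfl⟩ := Finsupp.mem_span_range_iff_exists_finsupp.1 hw
    have := (posSemidef_gramPow c (d := d) n).2 x
    convert this using 1
    simp only [Finsupp.sum, map_sum, LinearMap.sum_apply, map_smulₛₗ, LinearMap.smul_apply,
      form_pow, if_true, smul_eq_mul, RingHom.id_apply]
    try rw [Finset.sum_comm]
    refine Finset.sum_congr rfl fun i _ => ?_
    try rw [Finset.mul_sum]
    refine Finset.sum_congr rfl fun j _ => ?_
    simp only [RCLike.star_def]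
    ring
  have horth : ∀ n m, n ≠ m → ∀ w ∈ W n, ∀ w' ∈ W m, form c w w' = 0 := by
    intro n m hnm w hw w' hw'
    obtain ⟨x, rfl⟩ := Finsupp.mem_span_range_iff_exists_finsupp.1 hw
    obtain ⟨y, rfl⟩ := Finsupp.mem_span_range_iff_exists_finsupp.1 hw'
    simp [Finsupp.sum, form_pow, hnm]
  obtain ⟨w, hw, rfl⟩ := (Submodule.mem_iSup_iff_exists_finsupp W v).1 hW
  have : form c (w.sum fun _ x => x) (w.sum fun _ x => x) =
      ∑ n ∈ w.support, form c (w n) (w n) := by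
    simp only [Finsupp.sum, map_sum, LinearMap.sum_apply]
    refine Finset.sum_congr rfl fun n hn => ?_
    rw [Finset.sum_eq_single n]
    · intro m _ hm
      exact horth _ _ hm _ (hw _) _ (hw _)
    · exact fun h => absurd hn h
  rw [this]
  exact Finset.sum_nonneg fun n _ => hdiag n _ (hw n)

theorem form_act (x : RSWN c d) (u v : VacuumModule d) :
    form c (act c x u) v = form c u (act c (star x) v) := by
  have hann : form c (ann c x.q u) v = form c u (gen (star x.q) * v) := by
    rw [← form_conj, ← form_conj c u, form_gen_mul, star_star]
  simp only [act_apply, map_add, LinearMap.add_apply, map_smulₛₗ, LinearMap.smul_apply, hann,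
    form_gen_mul, form_num, RSWN.star_p, RSWN.star_q, RSWN.star_n, RSWN.star_z, RingHom.id_apply]
  abel

end VacuumModule

section State

variable {c : ℝ≥0} {d : ℕ}

theorem enveloping_induct {P : Enveloping c d → Prop} (one : P 1)
    (gen : ∀ x, P (inU c d x)) (mul : ∀ x y, P x → P y → P (x * y))
    (add : ∀ x y, P x → P y → P (x + y)) (smul : ∀ (a : ℂ) x, P x → P (a • x))
    (x : Enveloping c d) : P x := by
  obtain ⟨y, rfl⟩ : ∃ y, UniversalEnvelopingAlgebra.mkAlgHom ℂ (RSWN c d) y = x :=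
    RingCon.mkₐ_surjective _ x
  induction y using TensorAlgebra.induction with
  | algebraMap r => rw [AlgHom.commutes, Algebra.algebraMap_eq_smul_one]; exact smul r 1 one
  | ι x => exact gen x
  | mul a b ha hb => rw [map_mul]; exact mul _ _ ha hb
  | add a b ha hb => rw [map_add]; exact add _ _ ha hb

theorem form_vacuumRep (x : Enveloping c d) (u v : VacuumModule d) :
    VacuumModule.form c (vacuumRep c d x u) v =
      VacuumModule.form c u (vacuumRep c d (star x) v) := by
  induction x using enveloping_induct generalizing u v with
  | one => rw [star_one_U, map_one]; rfl
  | gen x => rw [star_inU, vacuumRep_inU, vacuumRep_inU, VacuumModule.form_act]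
  | mul x y hx hy =>
    rw [star_mul_U, map_mul, map_mul, Module.End.mul_apply, Module.End.mul_apply, hx, hy]
  | add x y hx hy => simp [star_add_U, hx, hy]
  | smul a x hx => simp [star_smul_U, hx]

theorem fockState_star_mul (x y : Enveloping c d) :
    fockState c d (star x * y) =
      VacuumModule.form c (vacuumRep c d x 1) (vacuumRep c d y 1) := by
  rw [form_vacuumRep, VacuumModule.form_one, ← Module.End.mul_apply, ← map_mul]
  rfl

/-- The quadratic Fock state is hermitian. -/
theorem conj_fockState (x y : Enveloping c d) :
    conj (fockState c d (star y * x)) = fockState c d (star x * y) := by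
  rw [fockState_star_mul, fockState_star_mul, VacuumModule.form_conj]

open scoped ComplexOrder in
/-- The quadratic Fock state is positive. -/
theorem fockState_nonneg (x : Enveloping c d) : 0 ≤ fockState c d (star x * x) := by
  rw [fockState_star_mul]
  exact VacuumModule.form_nonneg c _

end State

/-! ### The quadratic Fock space -/

/-- The universal enveloping algebra `U(RSWN)`, as the pre-Hilbert space of the GNS construction
for the quadratic Fock state. -/
def PreFock (c : ℝ≥0) (d : ℕ) : Type := Enveloping c d

instance (c : ℝ≥0) (d : ℕ) : AddCommGroup (PreFock c d) := inferInstanceAs (AddCommGroup (Enveloping c d))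

instance (c : ℝ≥0) (d : ℕ) : Module ℂ (PreFock c d) := inferInstanceAs (Module ℂ (Enveloping c d))

/-- The GNS scalar product `⟨x, y⟩ = φ(x* y)`. -/
abbrev preFockCore (c : ℝ≥0) (d : ℕ) : PreInnerProductSpace.Core ℂ (PreFock c d) where
  inner x y := fockState c d (star (show Enveloping c d from x) * (show Enveloping c d from y))
  conj_inner_symm x y := conj_fockState (c := c) (d := d) x y
  re_inner_nonneg x := (RCLike.nonneg_iff.1 (fockState_nonneg (c := c) (d := d) x)).1
  add_left x y z := by
    refine Eq.trans (congrArg (fun w => fockState c d (w * (show Enveloping c d from z)))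
      (star_add_U (show Enveloping c d from x) (show Enveloping c d from y))) ?_
    rw [add_mul, map_add]
  smul_left x y a := by
    refine Eq.trans (congrArg (fun w => fockState c d (w * (show Enveloping c d from y)))
      (star_smul_U a (show Enveloping c d from x))) ?_
    rw [smul_mul_assoc, map_smul, smul_eq_mul]

instance (c : ℝ≥0) (d : ℕ) : SeminormedAddCommGroup (PreFock c d) :=
  InnerProductSpace.Core.toSeminormedAddCommGroup (c := preFockCore c d)

instance (c : ℝ≥0) (d : ℕ) : InnerProductSpace ℂ (PreFock c d) :=
  InnerProductSpace.ofCore (preFockCore c d)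

/-- The quadratic Fock space `Γ₂(L² ∩ L^∞)`: the (Hausdorff) completion of `U(RSWN)` for the GNS
scalar product of the quadratic Fock state. -/
abbrev FockSpace (c : ℝ≥0) (d : ℕ) : Type := UniformSpace.Completion (PreFock c d)

/-- The vector `x Φ` of the quadratic Fock space, for `x` in `U(RSWN)`. -/
def toFock {c : ℝ≥0} {d : ℕ} (x : Enveloping c d) : FockSpace c d :=
  ((show PreFock c d from x : PreFock c d) : UniformSpace.Completion (PreFock c d))

theorem inner_toFock {c : ℝ≥0} {d : ℕ} (x y : Enveloping c d) :
    inner ℂ (toFock x) (toFock y) = fockState c d (star x * y) :=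
  UniformSpace.Completion.inner_coe _ _

/-- The vector `(B⁺_f)ⁿ Φ`. -/
def creationPowVacuum (c : ℝ≥0) {d : ℕ} (f : TestAlgebra d) (n : ℕ) : FockSpace c d :=
  toFock (inU c d (RSWN.creation f) ^ n)

/-- The quadratic exponential vector with test function `f` exists, i.e. the series
`∑ₙ (B⁺_f)ⁿ Φ / n!` converges. -/
def ExpVectorExists (c : ℝ≥0) {d : ℕ} (f : TestAlgebra d) : Prop :=
  Summable fun n : ℕ => ((n.factorial : ℂ)⁻¹) • creationPowVacuum c f n

/-- The quadratic exponential vector `Ψ(f) = ∑ₙ (B⁺_f)ⁿ Φ / n!`. -/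
def expVector (c : ℝ≥0) {d : ℕ} (f : TestAlgebra d) : FockSpace c d :=
  ∑' n : ℕ, ((n.factorial : ℂ)⁻¹) • creationPowVacuum c f n

/-! ### Quadratic second quantization -/

/-- `G` is the quadratic second quantization `Γ₂(T)` of `T`: the linear operator defined on the
linear span of all the quadratic exponential vectors that maps `Ψ(f)` to `Ψ(T f)` for all `f`
such that `Ψ(f)` exists; in particular `Ψ(T f)` has to exist for all these `f`. -/
def IsSecondQuantization {c : ℝ≥0} {d : ℕ} (T : TestAlgebra d →ₗ[ℂ] TestAlgebra d)
    (G : FockSpace c d →ₗ.[ℂ] FockSpace c d) : Prop :=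
  G.domain = Submodule.span ℂ {ψ | ∃ f : TestAlgebra d, ExpVectorExists c f ∧ ψ = expVector c f} ∧
    ∀ f : TestAlgebra d, ExpVectorExists c f → ExpVectorExists c (T f) ∧
      ∀ x : G.domain, (x : FockSpace c d) = expVector c f → G x = expVector c (T f)

/-- `Γ₂(T)` exists and is an isometry. -/
def SecondQuantizationIsometric (c : ℝ≥0) {d : ℕ} (T : TestAlgebra d →ₗ[ℂ] TestAlgebra d) : Prop :=
  ∃ G : FockSpace c d →ₗ.[ℂ] FockSpace c d, IsSecondQuantization T G ∧
    ∀ x : G.domain, ‖G x‖ = ‖(x : FockSpace c d)‖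

/-- `Γ₂(T)` exists and is unitary, i.e. it extends to a unitary operator of the Fock space. -/
def SecondQuantizationUnitary (c : ℝ≥0) {d : ℕ} (T : TestAlgebra d →ₗ[ℂ] TestAlgebra d) : Prop :=
  ∃ G : FockSpace c d →ₗ.[ℂ] FockSpace c d, IsSecondQuantization T G ∧
    ∃ U : FockSpace c d ≃ₗᵢ[ℂ] FockSpace c d, ∀ x : G.domain, U x = G x

/-! ### Endomorphisms of the Hilbert algebra -/

/-- A `*`-endomorphism of the Hilbert algebra `L² ∩ L^∞`: a linear map that is isometric for the
`L²` scalar product, multiplicative, and compatible with complex conjugation. -/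
structure IsStarEndomorphism {d : ℕ} (T : TestAlgebra d →ₗ[ℂ] TestAlgebra d) : Prop where
  scalar_map : ∀ f g, TestAlgebra.scalar (T f) (T g) = TestAlgebra.scalar f g
  map_mul : ∀ f g, T (f * g) = T f * T g
  map_star : ∀ f, T (star f) = star (T f)

/-- A `*`-automorphism of the Hilbert algebra `L² ∩ L^∞`: a `*`-endomorphism that is unitary for
the pre-Hilbert structure, i.e. maps `L² ∩ L^∞` onto itself. -/
structure IsStarAutomorphism {d : ℕ} (T : TestAlgebra d →ₗ[ℂ] TestAlgebra d) : Prop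
    extends IsStarEndomorphism T where
  surjective : Function.Surjective T

/-- `T = e^{iα} T₁`. -/
def IsPhaseMultiple {d : ℕ} (α : EuclideanSpace ℝ (Fin d) → ℝ)
    (T T₁ : TestAlgebra d →ₗ[ℂ] TestAlgebra d) : Prop :=
  ∀ f : TestAlgebra d, ∀ᵐ x : EuclideanSpace ℝ (Fin d),
    T f x = Complex.exp (Complex.I * α x) * T₁ f x

end QuadraticFock

end

/-!
The whole question reduces to the moments `⟨fᵏ, gᵏ⟩`, `k ≥ 1`, of the test functions.

The commutation relations give (`VacuumModule.normGram_succ`) a recursion for the numbers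
`Lₙ(f, g) = ⟨(B⁺_f)ⁿ Φ, (B⁺_g)ⁿ Φ⟩ / (n!)²`, namely
`(n + 1) Lₙ₊₁ = ∑_{k ≤ n} 2c 4ᵏ ⟨fᵏ⁺¹, gᵏ⁺¹⟩ Lₙ₋ₖ`, so that the `Lₙ` and the moments determine each
other. Since `⟨Ψ(f), Ψ(t g)⟩ = ∑ₙ tⁿ Lₙ(f, g)`, and since every test function has a positive multiple
for which the exponential vector exists, an isometric `Γ₂(T)` preserves all moments. Conversely, if
`T` preserves them, then the families `Ψ(f)` and `Ψ(T f)` have the same Gram matrix, and the terms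
of their series too, so `Γ₂(T)` exists and is isometric
(`secondQuantizationIsometric_iff_moment`).

It remains to see which linear `T` preserve the moments. A phase times a `*`-endomorphism does.
Conversely, polarizing the moments of orders one to three shows that
`‖T (f \bar g k) - T f \overline{T g} T k‖² = 0`: the map `T` is a homomorphism of triple systems
(`map_triple`). Hence the images of the indicator functions `eₙ` of balls have absolute values `0`
and `1`, and they extend each other; their common phase `e^{iα}` is such that `e^{-iα} T` is
multiplicative and compatible with the conjugation on functions supported in a ball, hence
everywhere by `L²`-continuity (`exists_isStarEndomorphism`).

For the unitary case, a surjective `T` makes the range of `Γ₂(T)` contain all exponential vectors,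
which are total. Conversely, if `Γ₂(T)` has a unitary extension, its range being dense forces
the vectors `B⁺_{T f} Φ` to be dense in the one-particle space, a multiple of `L²`; so
every test function `g` is the `L²`-limit of some `T₁ uₙ`. Then `uₙ` converges in `L²` to some `φ`,
and `‖φ k‖ = ‖g T₁ k‖ ≤ ‖g‖_∞ ‖k‖` shows that `φ` is bounded (`exists_map_eq_of_tendsto`), so
`T₁ φ = g`.
-/

noncomputable section

namespace QuadraticFock

/-! ### Scalar products of powers of creation operators -/

namespace VacuumModule

variable {d : ℕ} (c : ℝ≥0)

/-- The number `⟨(B⁺_f)ⁿ Φ, (B⁺_g)ⁿ Φ⟩ / (n!)²`, with `q` in the place of `\bar f`. -/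
def normGram (n : ℕ) (q g : TestAlgebra d) : ℂ :=
  vac d ((ann c q ^ n) (gen g ^ n)) / (n.factorial : ℂ) ^ 2

theorem normGram_zero (q g : TestAlgebra d) : normGram c 0 q g = 1 := by
  simp [normGram]

/-- `vac_two_step` lowers the degree by two, which reproduces the geometric pattern of the
coefficients `2c · 4ᵏ`. -/
theorem vac_recursion (n : ℕ) (q g p : TestAlgebra d) :
    vac d ((ann c q ^ (n + 1)) (gen p * gen g ^ n)) =
      n.factorial * (n + 1).factorial * ∑ k ∈ Finset.range (n + 1),
        2 * (c : ℂ) * 4 ^ k * TestAlgebra.pairing q ((fun x => q * g * x)^[k] p) *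
          normGram c (n - k) q g := by
  induction n using Nat.strong_induction_on generalizing p with
  | _ n ih =>
  have hV : ∀ m : ℕ, vac d ((ann c q ^ m) (gen g ^ m)) =
      (m.factorial : ℂ) ^ 2 * normGram c m q g := fun m => by
    rw [normGram, mul_div_cancel₀]
    exact pow_ne_zero _ (Nat.cast_ne_zero.2 m.factorial_ne_zero)
  rcases n with _ | n
  · rw [pow_zero, mul_one, vac_zero_step]
    simp [normGram_zero]
  · rw [vac_two_step, hV, Nat.add_sub_cancel, hV]
    rcases n with _ | n
    · simp [Finset.sum_range_succ, Nat.factorial]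
      ring
    · rw [Nat.add_sub_cancel, ih n (by omega), Finset.sum_range_succ' _ (n + 1 + 1),
        Finset.sum_range_succ' _ (n + 1)]
      have key : ∀ k ∈ Finset.range (n + 1),
          2 * (c : ℂ) * 4 ^ (k + 1 + 1) *
            TestAlgebra.pairing q ((fun x => q * g * x)^[k + 1 + 1] p) *
            normGram c (n + 1 + 1 - (k + 1 + 1)) q g =
          16 * (2 * (c : ℂ) * 4 ^ k *
            TestAlgebra.pairing q ((fun x => q * g * x)^[k] (q * g * (q * g * p))) *
            normGram c (n - k) q g) := by
        intro k _
        rw [Function.iterate_succ_apply, Function.iterate_succ_apply,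
          show n + 1 + 1 - (k + 1 + 1) = n - k by omega]
        ring
      rw [Finset.sum_congr rfl key, ← Finset.mul_sum]
      simp [Nat.factorial]
      ring

/-- The coefficients of `exp (c/2 ∑ₖ 4ᵏ tᵏ ⟨fᵏ, gᵏ⟩ / k)` satisfy this recursion. -/
theorem normGram_succ (n : ℕ) (q g : TestAlgebra d) :
    (n + 1 : ℂ) * normGram c (n + 1) q g = ∑ k ∈ Finset.range (n + 1),
        2 * (c : ℂ) * 4 ^ k * TestAlgebra.pairing q ((fun x => q * g * x)^[k] g) *
          normGram c (n - k) q g := by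
  have h := vac_recursion c n q g g
  rw [← pow_succ'] at h
  have h0 : (n.factorial : ℂ) ≠ 0 := Nat.cast_ne_zero.2 n.factorial_ne_zero
  have h1 : (n : ℂ) + 1 ≠ 0 := Nat.cast_add_one_ne_zero n
  rw [normGram, h, Nat.factorial_succ]
  push_cast
  field_simp

end VacuumModule

/-- The number `⟨fᵏ⁺¹, gᵏ⁺¹⟩`. -/
def moment {d : ℕ} (k : ℕ) (f g : TestAlgebra d) : ℂ :=
  TestAlgebra.pairing (star f) ((fun x => star f * g * x)^[k] g)

section Gram

variable {d : ℕ} (c : ℝ≥0)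

/-- The `n`-th term `(B⁺_f)ⁿ Φ / n!` of the exponential series. -/
def expTerm (f : TestAlgebra d) (n : ℕ) : FockSpace c d :=
  ((n.factorial : ℂ)⁻¹) • creationPowVacuum c f n

theorem inner_toFock_eq_form (x y : Enveloping c d) :
    inner ℂ (toFock x) (toFock y) =
      VacuumModule.form c (vacuumRep c d x 1) (vacuumRep c d y 1) := by
  rw [inner_toFock, fockState_star_mul]

theorem vacuumRep_creation_pow (f : TestAlgebra d) (n : ℕ) :
    vacuumRep c d (inU c d (RSWN.creation f) ^ n) 1 = VacuumModule.gen f ^ n := by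
  induction n with
  | zero => simp
  | succ n ih =>
    have a0 : VacuumModule.ann c (0 : TestAlgebra d) = 0 := by
      simpa using VacuumModule.ann_smul c 0 (0 : TestAlgebra d)
    have n0 : VacuumModule.num (0 : TestAlgebra d) = 0 := by
      simpa using VacuumModule.num_smul 0 (0 : TestAlgebra d)
    rw [pow_succ', map_mul, Module.End.mul_apply, ih, vacuumRep_inU, VacuumModule.act_apply]
    simp [RSWN.creation, a0, n0, pow_succ']

theorem inner_expTerm (f g : TestAlgebra d) (n m : ℕ) :
    inner ℂ (expTerm c f n) (expTerm c g m) =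
      if n = m then VacuumModule.normGram c n (star f) g else 0 := by
  rw [expTerm, expTerm, inner_smul_left, inner_smul_right, creationPowVacuum, creationPowVacuum,
    inner_toFock_eq_form, vacuumRep_creation_pow, vacuumRep_creation_pow, VacuumModule.form_pow]
  split_ifs with h
  · subst h
    rw [VacuumModule.normGram, VacuumModule.gramPow, Matrix.of_apply, map_inv₀, map_natCast]
    field_simp
  · simp

/-- The map `x ↦ x Φ`, as a linear map. -/
def toFockLinear : Enveloping c d →ₗ[ℂ] FockSpace c d where
  toFun := toFock
  map_add' x y := UniformSpace.Completion.coe_add (α := PreFock c d) x y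
  map_smul' z x := UniformSpace.Completion.coe_smul (X := PreFock c d) z x

theorem expTerm_smul (z : ℂ) (f : TestAlgebra d) (n : ℕ) :
    expTerm c (z • f) n = z ^ n • expTerm c f n := by
  have h1 : (RSWN.creation (z • f) : RSWN c d) = z • RSWN.creation f := by
    ext1 <;> simp [RSWN.creation]
  have h2 : ∀ (w : ℂ) (x : Enveloping c d), (toFock (w • x) : FockSpace c d) = w • toFock x :=
    fun w x => (toFockLinear c).map_smul w x
  rw [expTerm, expTerm, creationPowVacuum, creationPowVacuum, h1, map_smul, smul_pow, h2,
    smul_comm]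

/-- The vectors `(B⁺_f)ⁿ Φ` are total: modulo null vectors, `U(RSWN) Φ` is the vacuum module, which
is spanned by the powers of its generators. -/
theorem topologicalClosure_span_expTerm :
    (Submodule.span ℂ (Set.range fun i : ℕ × TestAlgebra d =>
      expTerm c i.2 i.1)).topologicalClosure = ⊤ := by
  set W := Submodule.span ℂ (Set.range fun i : ℕ × TestAlgebra d => expTerm c i.2 i.1) with hW
  have hpow : ∀ (n : ℕ) (f : TestAlgebra d),
      toFock (inU c d (RSWN.creation f) ^ n) ∈ W := by
    intro n f
    have h0 : (n.factorial : ℂ) ≠ 0 := Nat.cast_ne_zero.2 n.factorial_ne_zero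
    have h : (toFock (inU c d (RSWN.creation f) ^ n) : FockSpace c d) =
        (n.factorial : ℂ) • expTerm c f n := by
      rw [expTerm, smul_inv_smul₀ h0, creationPowVacuum]
    rw [h]
    exact W.smul_mem _ (Submodule.subset_span ⟨(n, f), rfl⟩)
  have hlift : ∀ v : VacuumModule d, ∃ y : Enveloping c d, vacuumRep c d y 1 = v ∧
      toFock y ∈ W := by
    intro v
    have hv : v ∈ Submodule.span ℂ
        (Set.range fun i : ℕ × TestAlgebra d => VacuumModule.gen i.2 ^ i.1) := by
      rw [VacuumModule.span_pow]; trivial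
    induction hv using Submodule.span_induction with
    | mem x hx =>
      obtain ⟨i, rfl⟩ := hx
      exact ⟨_, vacuumRep_creation_pow c i.2 i.1, hpow _ _⟩
    | zero => exact ⟨0, by simp, by
        rw [show (toFock (0 : Enveloping c d) : FockSpace c d) = 0 from (toFockLinear c).map_zero]
        exact W.zero_mem⟩
    | add x y _ _ hx hy =>
      obtain ⟨a, rfl, ha⟩ := hx
      obtain ⟨b, rfl, hb⟩ := hy
      refine ⟨a + b, by simp, ?_⟩
      rw [show (toFock (a + b) : FockSpace c d) = toFock a + toFock b from
        (toFockLinear c).map_add a b]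
      exact W.add_mem ha hb
    | smul z x _ hx =>
      obtain ⟨a, rfl, ha⟩ := hx
      refine ⟨z • a, by simp, ?_⟩
      rw [show (toFock (z • a) : FockSpace c d) = z • toFock a from
        (toFockLinear c).map_smul z a]
      exact W.smul_mem z ha
  have hall : ∀ x : Enveloping c d, toFock x ∈ W := by
    intro x
    obtain ⟨y, hy, hyW⟩ := hlift (vacuumRep c d x 1)
    have h0 : (toFock (x - y) : FockSpace c d) = 0 := by
      rw [← inner_self_eq_zero (𝕜 := ℂ), inner_toFock_eq_form, map_sub, LinearMap.sub_apply, hy]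
      simp
    have h1 : (toFock x : FockSpace c d) = toFock y := by
      rw [← sub_eq_zero, ← h0]
      exact ((toFockLinear c).map_sub x y).symm
    rw [h1]
    exact hyW
  refine Submodule.eq_top_iff'.2 fun v => ?_
  rw [← SetLike.mem_coe, Submodule.topologicalClosure_coe]
  refine UniformSpace.Completion.induction_on v isClosed_closure fun a => ?_
  exact subset_closure (hall a)

theorem summable_expTerm_iff (f : TestAlgebra d) :
    ExpVectorExists c f ↔ Summable (expTerm c f) := Iff.rfl

theorem hasSum_inner_expTerm {f : TestAlgebra d} (hf : ExpVectorExists c f)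
    (v : FockSpace c d) :
    HasSum (fun n => inner ℂ v (expTerm c f n)) (inner ℂ v (expVector c f)) :=
  (innerSL ℂ v).hasSum (Summable.hasSum hf)

theorem inner_expTerm_expVector {f : TestAlgebra d} (hf : ExpVectorExists c f)
    (g : TestAlgebra d) (n : ℕ) :
    inner ℂ (expTerm c g n) (expVector c f) = VacuumModule.normGram c n (star g) f := by
  refine (hasSum_inner_expTerm c hf (expTerm c g n)).unique ?_
  simp only [inner_expTerm]
  convert hasSum_ite_eq n (VacuumModule.normGram c n (star g) f) using 2
  simp only [eq_comm]

end Gram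

/-! ### Existence of exponential vectors with small test functions -/

namespace TestAlgebra

variable {d : ℕ}

theorem exists_ae_norm_le (f : TestAlgebra d) :
    ∃ C : ℝ, 0 ≤ C ∧ ∀ᵐ x : EuclideanSpace ℝ (Fin d), ‖f x‖ ≤ C := by
  have h := f.memLp_top.2
  refine ⟨(eLpNorm f ∞ volume).toReal, ENNReal.toReal_nonneg, ?_⟩
  filter_upwards [ae_le_eLpNormEssSup (f := f) (μ := volume)] with x hx
  rw [← eLpNorm_exponent_top] at hx
  simpa using ENNReal.toReal_mono h.ne hx

theorem coe_iterate_mul (q p : TestAlgebra d) (k : ℕ) :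
    ⇑((fun x => q * x)^[k] p).toAEEqFun =ᵐ[volume] fun x => q x ^ k * p x := by
  induction k with
  | zero => simp
  | succ k ih =>
    rw [Function.iterate_succ_apply']
    filter_upwards [coe_mul q ((fun x => q * x)^[k] p), ih] with x h1 h2
    rw [h1, h2, pow_succ', mul_assoc]

end TestAlgebra

section Moment

variable {d : ℕ}

open TestAlgebra

theorem moment_eq_integral (k : ℕ) (f g : TestAlgebra d) :
    moment k f g = ∫ x, (conj (f x) * g x) ^ (k + 1) := by
  rw [moment, pairing_apply]
  apply integral_congr_ae
  filter_upwards [coe_iterate_mul (star f * g) g k, coe_mul (star f) g, coe_star f]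
    with x h1 h2 h3
  rw [h1, h2, h3]
  ring

theorem moment_smul (k : ℕ) (z w : ℂ) (f g : TestAlgebra d) :
    moment k (z • f) (w • g) = (conj z * w) ^ (k + 1) * moment k f g := by
  rw [moment_eq_integral, moment_eq_integral, ← integral_const_mul]
  apply integral_congr_ae
  filter_upwards [coe_smul z f, coe_smul w g] with x h1 h2
  rw [h1, h2, map_mul]
  ring

theorem exists_norm_moment_le (f g : TestAlgebra d) :
    ∃ M r : ℝ, 0 ≤ M ∧ 0 ≤ r ∧ ∀ k, ‖moment k f g‖ ≤ M * r ^ k := by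
  obtain ⟨C, hC, hf⟩ := exists_ae_norm_le (star f * g)
  refine ⟨∫ x, ‖star f x * g x‖, C, integral_nonneg fun _ => norm_nonneg _, hC, fun k => ?_⟩
  rw [moment, pairing_apply, mul_comm _ (C ^ k), ← integral_const_mul]
  refine norm_integral_le_of_norm_le ((integrable_mul _ _).norm.const_mul _) ?_
  filter_upwards [coe_iterate_mul (star f * g) g k, hf] with x h1 h2
  rw [h1, mul_left_comm, norm_mul, norm_pow]
  gcongr

end Moment

section Existence

variable {d : ℕ} (c : ℝ≥0)

/-- The coefficients are majorized by a geometric sequence: if `2c 4ᵏ |⟨fᵏ⁺¹, gᵏ⁺¹⟩| ≤ C Rᵏ`, then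
the ratio `R + C` does. -/
theorem exists_norm_normGram_le (f g : TestAlgebra d) :
    ∃ A : ℝ, 0 ≤ A ∧ ∀ n, ‖VacuumModule.normGram c n (star f) g‖ ≤ A ^ n := by
  obtain ⟨M, r, hM, hr, h⟩ := exists_norm_moment_le f g
  set C : ℝ := 2 * c * M with hCdef
  set R : ℝ := 4 * r with hRdef
  have hC : 0 ≤ C := by positivity
  have hR : 0 ≤ R := by positivity
  refine ⟨C + R, by positivity, fun n => ?_⟩
  induction n using Nat.strong_induction_on with
  | _ n ih =>
  rcases n with _ | n
  · simp [VacuumModule.normGram_zero]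
  have h1 : ‖(n + 1 : ℂ) * VacuumModule.normGram c (n + 1) (star f) g‖ ≤
      ∑ k ∈ Finset.range (n + 1), C * (R ^ k * (C + R) ^ (n - k)) := by
    rw [VacuumModule.normGram_succ]
    refine norm_sum_le_of_le _ fun k _ => ?_
    have h2 := h k
    rw [moment] at h2
    simp only [norm_mul, norm_pow, Complex.norm_ofNat, Complex.norm_real, Real.norm_eq_abs,
      NNReal.abs_eq]
    calc _ ≤ 2 * (c : ℝ) * 4 ^ k * (M * r ^ k) * (C + R) ^ (n - k) := by
          gcongr
          exact ih _ (by omega)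
      _ = _ := by rw [hCdef, hRdef, mul_pow]; ring
  have h3 : ∑ k ∈ Finset.range (n + 1), C * (R ^ k * (C + R) ^ (n - k)) =
      (C + R) ^ (n + 1) - R ^ (n + 1) := by
    have := (Commute.all R (C + R)).geom_sum₂_mul (n + 1)
    rw [← Finset.mul_sum]
    simp only [Nat.add_sub_cancel] at this
    linear_combination -this
  rw [h3, norm_mul, show ((n : ℂ) + 1) = ((n + 1 : ℕ) : ℂ) by push_cast; rfl,
    Complex.norm_natCast] at h1
  have h4 : ‖VacuumModule.normGram c (n + 1) (star f) g‖ ≤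
      ((n + 1 : ℕ) : ℝ) * ‖VacuumModule.normGram c (n + 1) (star f) g‖ :=
    le_mul_of_one_le_left (norm_nonneg _) (by simp)
  have h5 : 0 ≤ R ^ (n + 1) := by positivity
  linarith

/-- Every test function has a positive multiple whose exponential series converges absolutely. -/
theorem exists_summable_norm_expTerm (f : TestAlgebra d) :
    ∃ ε : ℝ, 0 < ε ∧ Summable fun n => ‖expTerm c ((ε : ℂ) • f) n‖ := by
  obtain ⟨A, hA, h⟩ := exists_norm_normGram_le c f f
  have h1 : ∀ n, ‖expTerm c f n‖ ≤ (A + 1) ^ n := fun n => by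
    refine le_of_sq_le_sq ?_ (by positivity)
    have h2 := h n
    have h3 := inner_self_eq_norm_sq_to_K (𝕜 := ℂ) (expTerm c f n)
    rw [inner_expTerm, if_pos rfl] at h3
    rw [h3, norm_pow, RCLike.norm_ofReal, abs_norm] at h2
    refine h2.trans ?_
    calc A ^ n ≤ (A + 1) ^ n := by gcongr; linarith
      _ ≤ ((A + 1) ^ n) ^ 2 := le_self_pow₀ (one_le_pow₀ (by linarith)) two_ne_zero
  refine ⟨(2 * (A + 1))⁻¹, by positivity, ?_⟩
  refine Summable.of_nonneg_of_le (fun _ => norm_nonneg _) (fun n => ?_)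
    (summable_geometric_two)
  rw [expTerm_smul, norm_smul, norm_pow, Complex.norm_real, Real.norm_of_nonneg (by positivity)]
  calc _ ≤ ((2 * (A + 1))⁻¹) ^ n * (A + 1) ^ n := by gcongr; exact h1 n
    _ = (1 / 2) ^ n := by
      rw [← mul_pow]
      congr 1
      field_simp

theorem expVectorExists_smul {f : TestAlgebra d} (hf : Summable fun n => ‖expTerm c f n‖)
    {t : ℝ} (ht : 0 ≤ t) (ht' : t ≤ 1) : ExpVectorExists c ((t : ℂ) • f) := by
  rw [summable_expTerm_iff]
  refine Summable.of_norm_bounded hf fun n => ?_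
  rw [expTerm_smul, norm_smul, norm_pow, Complex.norm_real, Real.norm_of_nonneg ht]
  exact mul_le_of_le_one_left (norm_nonneg _) (pow_le_one₀ ht ht')

/-- Uniqueness of the coefficients of a power series that converges on `(0, 1]`. -/
theorem eq_of_hasSum_pow_mul {a b : ℕ → ℂ}
    (h : ∀ t : ℝ, 0 < t → t ≤ 1 → ∃ S, HasSum (fun n => (t : ℂ) ^ n * a n) S ∧
      HasSum (fun n => (t : ℂ) ^ n * b n) S) : a = b := by
  set e : ℕ → ℂ := fun n => a n - b n with he
  suffices ∀ n, e n = 0 from funext fun n => sub_eq_zero.1 (this n)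
  have h0 : ∀ t : ℝ, 0 < t → t ≤ 1 → HasSum (fun n => (t : ℂ) ^ n * e n) 0 := by
    intro t ht ht'
    obtain ⟨S, h1, h2⟩ := h t ht ht'
    simpa [he, mul_sub] using h1.sub h2
  obtain ⟨C, hC⟩ : ∃ C, ∀ n, ‖e n‖ ≤ C := by
    have h1 := (h0 1 one_pos le_rfl).summable.tendsto_atTop_zero.norm.bddAbove_range
    obtain ⟨C, hC⟩ := h1
    exact ⟨C, fun n => by simpa using hC ⟨n, rfl⟩⟩
  intro n
  induction n using Nat.strong_induction_on with
  | _ n ih =>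
  -- The terms before the `n`-th vanish, and the remainder is majorized by a geometric series.
  have h1 : ∀ t : ℝ, 0 < t → t ≤ 1 / 2 → ‖e n‖ ≤ t * (2 * C) := by
    intro t ht ht'
    have h2 := h0 t ht (by linarith)
    have h3 : ∑ i ∈ Finset.range (n + 1), (t : ℂ) ^ i * e i = (t : ℂ) ^ n * e n := by
      rw [Finset.sum_range_succ, Finset.sum_eq_zero, zero_add]
      intro i hi
      rw [ih i (Finset.mem_range.1 hi), mul_zero]
    have h4 := (hasSum_nat_add_iff' (n + 1)).2 h2
    rw [h3, zero_sub] at h4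
    have h5 : HasSum (fun i => t ^ (n + 1) * C * t ^ i) (t ^ (n + 1) * C * (1 - t)⁻¹) :=
      (hasSum_geometric_of_lt_one ht.le (by linarith)).mul_left _
    have h6 : ‖-((t : ℂ) ^ n * e n)‖ ≤ t ^ (n + 1) * C * (1 - t)⁻¹ := by
      refine h4.norm_le_of_bounded h5 fun i => ?_
      rw [norm_mul, norm_pow, Complex.norm_real, Real.norm_of_nonneg ht.le]
      calc _ ≤ t ^ (i + (n + 1)) * C := by gcongr; exact hC _
        _ = _ := by ring
    rw [norm_neg, norm_mul, norm_pow, Complex.norm_real, Real.norm_of_nonneg ht.le] at h6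
    have h7 : (1 - t)⁻¹ ≤ 2 := by
      rw [inv_le_comm₀ (by linarith) two_pos]
      linarith
    have hC0 : 0 ≤ C := (norm_nonneg _).trans (hC 0)
    have h8 : t ^ n * ‖e n‖ ≤ t ^ n * (t * (2 * C)) := by
      calc _ ≤ t ^ (n + 1) * C * (1 - t)⁻¹ := h6
        _ ≤ t ^ (n + 1) * C * 2 := by gcongr
        _ = _ := by ring
    exact le_of_mul_le_mul_left h8 (by positivity)
  by_contra hne
  have hpos : 0 < ‖e n‖ := norm_pos_iff.2 hne
  have hC0 : 0 < C := hpos.trans_le (hC n)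
  have h2 := h1 (min (1 / 2) (‖e n‖ / (4 * C))) (by positivity) (min_le_left _ _)
  have h3 : min (1 / 2) (‖e n‖ / (4 * C)) * (2 * C) ≤ ‖e n‖ / (4 * C) * (2 * C) := by
    gcongr
    exact min_le_right _ _
  have h4 : ‖e n‖ / (4 * C) * (2 * C) = ‖e n‖ / 2 := by field_simp; norm_num
  linarith

end Existence

/-! ### Second quantization and the moments `⟨fᵏ, gᵏ⟩` -/

section SecondQuantization

variable {d : ℕ} {c : ℝ≥0} {T : TestAlgebra d →ₗ[ℂ] TestAlgebra d}

/-- The coefficients `normGram` determine the moments. -/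
theorem moment_eq_of_normGram_eq (hc : 0 < c) {f g f' g' : TestAlgebra d}
    (h : ∀ n, VacuumModule.normGram c n (star f) g = VacuumModule.normGram c n (star f') g')
    (k : ℕ) : moment k f g = moment k f' g' := by
  induction k using Nat.strong_induction_on with
  | _ k ih =>
  have h1 := VacuumModule.normGram_succ c k (star f) g
  rw [h, VacuumModule.normGram_succ, Finset.sum_range_succ, Finset.sum_range_succ,
    Finset.sum_congr (g := fun i => 2 * (c : ℂ) * 4 ^ i *
      TestAlgebra.pairing (star f') ((fun x => star f' * g' * x)^[i] g') *
        VacuumModule.normGram c (k - i) (star f) g) rfl (fun i _ => by rw [h])] at h1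
  have h2 : ∀ i ∈ Finset.range k, 2 * (c : ℂ) * 4 ^ i *
      TestAlgebra.pairing (star f') ((fun x => star f' * g' * x)^[i] g') *
        VacuumModule.normGram c (k - i) (star f) g = 2 * (c : ℂ) * 4 ^ i *
      TestAlgebra.pairing (star f) ((fun x => star f * g * x)^[i] g) *
        VacuumModule.normGram c (k - i) (star f) g := fun i hi => by
    have := ih i (Finset.mem_range.1 hi)
    rw [moment, moment] at this
    rw [this]
  rw [Finset.sum_congr rfl h2, add_right_inj, Nat.sub_self, VacuumModule.normGram_zero,
    VacuumModule.normGram_zero, mul_one, mul_one] at h1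
  have hc' : (c : ℂ) ≠ 0 := by exact_mod_cast hc.ne'
  exact (mul_left_cancel₀ (by simp [hc']) h1).symm

theorem normGram_eq_of_moment_eq {f g f' g' : TestAlgebra d}
    (h : ∀ k, moment k f g = moment k f' g') (n : ℕ) :
    VacuumModule.normGram c n (star f) g = VacuumModule.normGram c n (star f') g' := by
  induction n using Nat.strong_induction_on with
  | _ n ih =>
  rcases n with _ | n
  · rw [VacuumModule.normGram_zero, VacuumModule.normGram_zero]
  have h0 : (n : ℂ) + 1 ≠ 0 := Nat.cast_add_one_ne_zero n
  refine mul_left_cancel₀ h0 ?_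
  rw [VacuumModule.normGram_succ, VacuumModule.normGram_succ]
  refine Finset.sum_congr rfl fun k _ => ?_
  have hk := h k
  rw [moment, moment] at hk
  rw [hk, ih _ (by omega)]

/-- An isometric second quantization preserves the moments: the scalar products
`⟨Ψ(f), Ψ(t g)⟩` are power series in `t` whose coefficients are the numbers `normGram`. -/
theorem moment_map_of_isometric (hc : 0 < c) {G : FockSpace c d →ₗ.[ℂ] FockSpace c d}
    (hG : IsSecondQuantization T G) (hiso : ∀ x : G.domain, ‖G x‖ = ‖(x : FockSpace c d)‖)
    (k : ℕ) (f g : TestAlgebra d) : moment k (T f) (T g) = moment k f g := by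
  have hinner : ∀ x y : G.domain, inner ℂ (G x) (G y) = inner ℂ (x : FockSpace c d) y :=
    (LinearMap.norm_map_iff_inner_map_map (𝕜 := ℂ) G.toFun).1 hiso
  have hmem : ∀ f : TestAlgebra d, ExpVectorExists c f → expVector c f ∈ G.domain := by
    intro f hf
    rw [hG.1]
    exact Submodule.subset_span ⟨f, hf, rfl⟩
  have hexp : ∀ f g : TestAlgebra d, ExpVectorExists c f → ExpVectorExists c g →
      inner ℂ (expVector c (T f)) (expVector c (T g)) =
        inner ℂ (expVector c f) (expVector c g) := by
    intro f g hf hg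
    have h := hinner ⟨_, hmem f hf⟩ ⟨_, hmem g hg⟩
    rwa [(hG.2 f hf).2 _ rfl, (hG.2 g hg).2 _ rfl] at h
  have hsmall : ∀ f g : TestAlgebra d, ExpVectorExists c f →
      (Summable fun n => ‖expTerm c g n‖) → moment k (T g) (T f) = moment k g f := by
    intro f g hf hg
    have key : (fun n => inner ℂ (expVector c (T f)) (expTerm c (T g) n)) =
        fun n => inner ℂ (expVector c f) (expTerm c g n) := by
      refine eq_of_hasSum_pow_mul fun t ht ht' => ?_
      have hgt := expVectorExists_smul c hg ht.le ht'
      refine ⟨inner ℂ (expVector c f) (expVector c ((t : ℂ) • g)), ?_, ?_⟩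
      · rw [← hexp f _ hf hgt]
        convert hasSum_inner_expTerm c (hG.2 _ hgt).1 (expVector c (T f)) using 2
        rw [map_smul, expTerm_smul, inner_smul_right]
      · convert hasSum_inner_expTerm c hgt (expVector c f) using 2
        rw [expTerm_smul, inner_smul_right]
    refine moment_eq_of_normGram_eq hc (fun n => ?_) k
    have h := congrArg conj (congrFun key n)
    rwa [inner_conj_symm, inner_conj_symm, inner_expTerm_expVector c (hG.2 f hf).1,
      inner_expTerm_expVector c hf] at h
  obtain ⟨ε, hε, hf⟩ := exists_summable_norm_expTerm c f
  obtain ⟨δ, hδ, hg⟩ := exists_summable_norm_expTerm c g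
  have h := hsmall _ _ (Summable.of_norm hg : ExpVectorExists c _) hf
  rw [map_smul, map_smul, moment_smul, moment_smul] at h
  refine mul_left_cancel₀ (pow_ne_zero _ (mul_ne_zero ?_ ?_)) h
  · simpa using hε.ne'
  · simpa using hδ.ne'

/-- A family of vectors with the Gram matrix of another one is its image under an isometry. -/
theorem exists_isometry_of_inner_eq {ι E : Type*} [NormedAddCommGroup E] [InnerProductSpace ℂ E]
    (v w : ι → E) (h : ∀ i j, inner ℂ (w i) (w j) = inner ℂ (v i) (v j)) :
    ∃ G : Submodule.span ℂ (Set.range v) →ₗ[ℂ] E,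
      (∀ x, ‖G x‖ = ‖x‖) ∧ ∀ i (x : Submodule.span ℂ (Set.range v)), (x : E) = v i → G x = w i := by
  have hnorm : ∀ a : ι →₀ ℂ, ‖Finsupp.linearCombination ℂ w a‖ =
      ‖Finsupp.linearCombination ℂ v a‖ := by
    intro a
    have h1 : inner ℂ (Finsupp.linearCombination ℂ w a) (Finsupp.linearCombination ℂ w a) =
        inner ℂ (Finsupp.linearCombination ℂ v a) (Finsupp.linearCombination ℂ v a) := by
      simp only [Finsupp.linearCombination_apply, Finsupp.sum_inner, Finsupp.inner_sum,
        inner_smul_left, inner_smul_right, h]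
    rw [inner_self_eq_norm_sq_to_K, inner_self_eq_norm_sq_to_K] at h1
    have h2 : ‖Finsupp.linearCombination ℂ w a‖ ^ 2 = ‖Finsupp.linearCombination ℂ v a‖ ^ 2 := by
      exact_mod_cast h1
    exact (sq_eq_sq₀ (norm_nonneg _) (norm_nonneg _)).1 h2
  rw [← Finsupp.range_linearCombination]
  obtain ⟨r, hr⟩ := (Finsupp.linearCombination ℂ v).rangeRestrict.exists_rightInverse_of_surjective
    (LinearMap.range_rangeRestrict _)
  have hr' : ∀ x : LinearMap.range (Finsupp.linearCombination ℂ v),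
      Finsupp.linearCombination ℂ v (r x) = (x : E) := fun x =>
    congrArg Subtype.val (LinearMap.congr_fun hr x)
  refine ⟨(Finsupp.linearCombination ℂ w).comp r, fun x => ?_, fun i x hx => ?_⟩
  · rw [LinearMap.comp_apply, hnorm, hr', Submodule.coe_norm]
  · have h1 := hnorm (r x - Finsupp.single i 1)
    rw [map_sub, map_sub, hr', hx, Finsupp.linearCombination_single,
      Finsupp.linearCombination_single, one_smul, one_smul, sub_self, norm_zero, norm_eq_zero,
      sub_eq_zero] at h1
    exact h1

/-- Summability and the scalar products of sums only depend on the scalar products of the terms. -/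
theorem summable_of_inner_eq {E : Type*} [NormedAddCommGroup E] [InnerProductSpace ℂ E]
    [CompleteSpace E] {v w : ℕ → E} (h : ∀ i j, inner ℂ (w i) (w j) = inner ℂ (v i) (v j))
    (hv : Summable v) : Summable w := by
  have hnorm : ∀ s : Finset ℕ, ‖∑ i ∈ s, w i‖ = ‖∑ i ∈ s, v i‖ := by
    intro s
    have h1 : inner ℂ (∑ i ∈ s, w i) (∑ i ∈ s, w i) =
        inner ℂ (∑ i ∈ s, v i) (∑ i ∈ s, v i) := by
      simp only [sum_inner, inner_sum, h]
    rw [inner_self_eq_norm_sq_to_K, inner_self_eq_norm_sq_to_K] at h1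
    have h2 : ‖∑ i ∈ s, w i‖ ^ 2 = ‖∑ i ∈ s, v i‖ ^ 2 := by exact_mod_cast h1
    exact (sq_eq_sq₀ (norm_nonneg _) (norm_nonneg _)).1 h2
  rw [summable_iff_vanishing_norm] at hv ⊢
  simpa only [hnorm] using hv

theorem inner_tsum_tsum_eq {E : Type*} [NormedAddCommGroup E] [InnerProductSpace ℂ E]
    {v w v' w' : ℕ → E} (h : ∀ i j, inner ℂ (w i) (w' j) = inner ℂ (v i) (v' j))
    (hv : Summable v) (hv' : Summable v') (hw : Summable w) (hw' : Summable w') :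
    inner ℂ (∑' i, w i) (∑' i, w' i) = inner ℂ (∑' i, v i) (∑' i, v' i) := by
  have h1 := Filter.Tendsto.inner (𝕜 := ℂ) hw.hasSum hw'.hasSum
  have h2 := Filter.Tendsto.inner (𝕜 := ℂ) hv.hasSum hv'.hasSum
  refine tendsto_nhds_unique h1 ?_
  convert h2 using 2
  simp only [sum_inner, inner_sum, h]

theorem inner_expTerm_map (h : ∀ k f g, moment k (T f) (T g) = moment k f g)
    (f g : TestAlgebra d) (n m : ℕ) :
    inner ℂ (expTerm c (T f) n) (expTerm c (T g) m) =
      inner ℂ (expTerm c f n) (expTerm c g m) := by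
  rw [inner_expTerm, inner_expTerm, normGram_eq_of_moment_eq fun k => h k f g]

theorem expVectorExists_map_iff (h : ∀ k f g, moment k (T f) (T g) = moment k f g)
    (f : TestAlgebra d) : ExpVectorExists c (T f) ↔ ExpVectorExists c f :=
  ⟨summable_of_inner_eq fun n m => (inner_expTerm_map h f f n m).symm,
    summable_of_inner_eq fun n m => inner_expTerm_map h f f n m⟩

theorem exists_isSecondQuantization (h : ∀ k f g, moment k (T f) (T g) = moment k f g) :
    ∃ G : FockSpace c d →ₗ.[ℂ] FockSpace c d, IsSecondQuantization T G ∧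
      ∀ x : G.domain, ‖G x‖ = ‖(x : FockSpace c d)‖ := by
  obtain ⟨G, hG, hGv⟩ := exists_isometry_of_inner_eq
    (fun f : {f : TestAlgebra d // ExpVectorExists c f} => expVector c f.1)
    (fun f => expVector c (T f.1)) (fun f g => inner_tsum_tsum_eq
      (fun n m => inner_expTerm_map h f.1 g.1 n m) f.2 g.2
      ((expVectorExists_map_iff h _).2 f.2) ((expVectorExists_map_iff h _).2 g.2))
  refine ⟨⟨_, G⟩, ⟨?_, fun f hf => ⟨(expVectorExists_map_iff h f).2 hf, fun x hx =>
    hGv ⟨f, hf⟩ x hx⟩⟩, hG⟩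
  refine congrArg (Submodule.span ℂ) (Set.ext fun ψ => ⟨?_, ?_⟩)
  · rintro ⟨f, rfl⟩
    exact ⟨f.1, f.2, rfl⟩
  · rintro ⟨f, hf, rfl⟩
    exact ⟨⟨f, hf⟩, rfl⟩

theorem secondQuantizationIsometric_iff_moment (hc : 0 < c) :
    SecondQuantizationIsometric c T ↔ ∀ k f g, moment k (T f) (T g) = moment k f g :=
  ⟨fun ⟨_, hG, hiso⟩ => moment_map_of_isometric hc hG hiso, exists_isSecondQuantization⟩

/-- A vector orthogonal to the exponential vectors `Ψ(t f)` is orthogonal to their Taylor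
coefficients. -/
theorem inner_expTerm_eq_zero {v : FockSpace c d}
    (h : ∀ f : TestAlgebra d, ExpVectorExists c f → inner ℂ v (expVector c f) = 0)
    (f : TestAlgebra d) (n : ℕ) : inner ℂ v (expTerm c f n) = 0 := by
  obtain ⟨ε, hε, hf⟩ := exists_summable_norm_expTerm c f
  have key : (fun n => inner ℂ v (expTerm c ((ε : ℂ) • f) n)) = fun _ => 0 := by
    refine eq_of_hasSum_pow_mul fun t ht ht' => ?_
    have hft := expVectorExists_smul c hf ht.le ht'
    refine ⟨0, ?_, by simp [hasSum_zero]⟩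
    rw [← h _ hft]
    convert hasSum_inner_expTerm c hft v using 2
    rw [expTerm_smul c (t : ℂ), inner_smul_right]
  have h1 := congrFun key n
  rw [expTerm_smul, inner_smul_right] at h1
  exact (mul_eq_zero.1 h1).resolve_left (pow_ne_zero _ (by simpa using hε.ne'))

theorem eq_zero_of_inner_expTerm {v : FockSpace c d}
    (h : ∀ (f : TestAlgebra d) (n : ℕ), inner ℂ v (expTerm c f n) = 0) : v = 0 := by
  have h1 : v ∈ (Submodule.span ℂ (Set.range fun i : ℕ × TestAlgebra d =>
      expTerm c i.2 i.1))ᗮ := by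
    rw [Submodule.mem_orthogonal']
    intro u hu
    induction hu using Submodule.span_induction with
    | mem x hx => obtain ⟨i, rfl⟩ := hx; exact h _ _
    | zero => exact inner_zero_right _
    | add x y _ _ hx hy => rw [inner_add_right, hx, hy, add_zero]
    | smul z x _ hx => rw [inner_smul_right, hx, mul_zero]
  rwa [← Submodule.orthogonal_closure, topologicalClosure_span_expTerm,
    Submodule.top_orthogonal_eq_bot, Submodule.mem_bot] at h1

theorem topologicalClosure_span_expVector :
    (Submodule.span ℂ {ψ | ∃ f : TestAlgebra d, ExpVectorExists c f ∧
      ψ = expVector c f}).topologicalClosure = ⊤ := by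
  rw [Submodule.topologicalClosure_eq_top_iff, Submodule.eq_bot_iff]
  intro v hv
  rw [Submodule.mem_orthogonal'] at hv
  exact eq_zero_of_inner_expTerm (inner_expTerm_eq_zero fun f hf =>
    hv _ (Submodule.subset_span ⟨f, hf, rfl⟩))

theorem secondQuantizationUnitary_of_surjective (hT : Function.Surjective T)
    (h : ∀ k f g, moment k (T f) (T g) = moment k f g) : SecondQuantizationUnitary c T := by
  obtain ⟨G, hG, hiso⟩ := exists_isSecondQuantization (c := c) h
  have hinj : Function.Injective G.toFun := by
    rw [← LinearMap.ker_eq_bot, LinearMap.ker_eq_bot']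
    intro x hx
    have h1 := hiso x
    rw [show G x = 0 from hx, norm_zero] at h1
    exact Subtype.ext (norm_eq_zero.1 h1.symm)
  have hd1 : DenseRange G.domain.subtype := by
    rw [DenseRange, Submodule.coe_subtype, Subtype.range_coe, hG.1,
      Submodule.dense_iff_topologicalClosure_eq_top]
    exact topologicalClosure_span_expVector
  have hd2 : DenseRange (LinearMap.range G.toFun).subtype := by
    rw [DenseRange, Submodule.coe_subtype, Subtype.range_coe,
      Submodule.dense_iff_topologicalClosure_eq_top, eq_top_iff,
      ← topologicalClosure_span_expVector (c := c) (d := d)]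
    refine Submodule.topologicalClosure_mono (Submodule.span_le.2 ?_)
    rintro _ ⟨g, hg, rfl⟩
    obtain ⟨f, rfl⟩ := hT g
    have hf := (expVectorExists_map_iff h f).1 hg
    have hmem : expVector c f ∈ G.domain := by
      rw [hG.1]
      exact Submodule.subset_span ⟨f, hf, rfl⟩
    exact ⟨⟨_, hmem⟩, (hG.2 f hf).2 _ rfl⟩
  refine ⟨G, hG, (LinearEquiv.ofInjective G.toFun hinj).extendOfIsometry G.domain.subtype
    (LinearMap.range G.toFun).subtype hd1 hd2 hiso, fun x => ?_⟩
  exact LinearEquiv.extendOfIsometry_eq _ _ _ hd1 hd2 hiso x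

variable (c) in
/-- The map `f ↦ B⁺_f Φ`. -/
def oneParticle : TestAlgebra d →ₗ[ℂ] FockSpace c d where
  toFun f := expTerm c f 1
  map_add' f f' := by
    have h1 : (RSWN.creation (f + f') : RSWN c d) = RSWN.creation f + RSWN.creation f' := by
      ext1 <;> simp [RSWN.creation]
    simp only [expTerm, creationPowVacuum, pow_one, h1, map_add, ← smul_add]
    congr 1
    exact (toFockLinear c).map_add _ _
  map_smul' z f := by rw [expTerm_smul, pow_one]; rfl

/-- If the second quantization is unitary, then the one-particle vectors `B⁺_{T f} Φ` are dense
among the one-particle vectors: the component of `B⁺_g Φ` that is orthogonal to them is orthogonal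
to all `Ψ(T f)`, as different particle numbers are orthogonal. -/
theorem oneParticle_mem_closure_of_unitary {G : FockSpace c d →ₗ.[ℂ] FockSpace c d}
    (hG : IsSecondQuantization T G) (U : FockSpace c d ≃ₗᵢ[ℂ] FockSpace c d)
    (hU : ∀ x : G.domain, U x = G x) (g : TestAlgebra d) :
    oneParticle c g ∈ closure (Set.range fun f => oneParticle c (T f)) := by
  set W := (LinearMap.range (oneParticle c ∘ₗ T)).topologicalClosure with hW
  have hWc : (W : Set (FockSpace c d)) = closure (Set.range fun f => oneParticle c (T f)) := by
    rw [hW, Submodule.topologicalClosure_coe]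
    rfl
  have : CompleteSpace W := (Submodule.isClosed_topologicalClosure _).completeSpace_coe
  set v := oneParticle c g - W.starProjection (oneParticle c g) with hv
  have hvW : v ∈ Wᗮ := Submodule.sub_starProjection_mem_orthogonal _
  have hort : ∀ (f : TestAlgebra d) (n : ℕ), inner ℂ v (expTerm c (T f) n) = 0 := by
    intro f n
    by_cases hn : n = 1
    · subst hn
      rw [Submodule.mem_orthogonal'] at hvW
      exact hvW _ (Submodule.le_topologicalClosure _ ⟨f, rfl⟩)
    · have hone : ∀ f f' : TestAlgebra d, inner ℂ (oneParticle c f) (expTerm c f' n) = 0 :=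
        fun f f' => (inner_expTerm c f f' 1 n).trans (if_neg (Ne.symm hn))
      have h1 : ∀ x ∈ W, inner ℂ x (expTerm c (T f) n) = 0 := by
        intro x hx
        rw [← SetLike.mem_coe, hWc] at hx
        refine closure_minimal ?_ (isClosed_eq (f := fun x => inner ℂ x (expTerm c (T f) n))
          (by fun_prop) continuous_const) hx
        rintro _ ⟨f', rfl⟩
        exact hone (T f') (T f)
      rw [hv, inner_sub_left, h1 _ (Submodule.starProjection_apply_mem _ _), hone,
        sub_zero]
  -- `U⁻¹ v` is orthogonal to all `Ψ(f)`, because `v` is orthogonal to `U Ψ(f) = Ψ(T f)`.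
  have h0 : U.symm v = 0 := by
    refine eq_zero_of_inner_expTerm (inner_expTerm_eq_zero fun f hf => ?_)
    have hmem : expVector c f ∈ G.domain := by
      rw [hG.1]
      exact Submodule.subset_span ⟨f, hf, rfl⟩
    rw [← U.inner_map_map, U.apply_symm_apply, hU ⟨_, hmem⟩, (hG.2 f hf).2 _ rfl]
    have h1 := hasSum_inner_expTerm c (hG.2 f hf).1 v
    simp only [hort] at h1
    exact h1.unique hasSum_zero
  have h1 : v = 0 := by simpa using h0
  rw [← hWc, SetLike.mem_coe, sub_eq_zero.1 (hv.symm.trans h1)]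
  exact Submodule.starProjection_apply_mem _ _

theorem inner_oneParticle (f g : TestAlgebra d) :
    inner ℂ (oneParticle c f) (oneParticle c g) = 2 * c * TestAlgebra.scalar f g := by
  have h2 := VacuumModule.normGram_succ c 0 (star f) g
  simp only [Nat.cast_zero, zero_add, one_mul, Finset.sum_range_one, pow_zero, mul_one,
    Function.iterate_zero_apply, Nat.sub_self, VacuumModule.normGram_zero,
    TestAlgebra.pairing_star] at h2
  rw [← h2]
  exact (inner_expTerm c f g 1 1).trans (if_pos rfl)

end SecondQuantization

/-! ### The test function algebra as a dense subspace of `L²` -/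

namespace TestAlgebra

variable {d : ℕ}

/-- The inclusion of the test functions into the Hilbert space `L²(ℝᵈ)`. -/
def toL2 : TestAlgebra d →ₗ[ℂ] Lp ℂ 2 (volume : Measure (EuclideanSpace ℝ (Fin d))) where
  toFun f := ⟨f.toAEEqFun, Lp.mem_Lp_iff_memLp.2 f.memLp_two⟩
  map_add' _ _ := rfl
  map_smul' _ _ := rfl

theorem coe_toL2 (f : TestAlgebra d) : (toL2 f : EuclideanSpace ℝ (Fin d) → ℂ) = f := rfl

theorem toL2_injective : Function.Injective (toL2 (d := d)) := fun _ _ h =>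
  Subtype.ext (congrArg Subtype.val h :)

theorem inner_toL2 (f g : TestAlgebra d) : inner ℂ (toL2 f) (toL2 g) = scalar f g := by
  rw [L2.inner_def, scalar]
  simp only [coe_toL2, RCLike.inner_apply, mul_comm]

theorem norm_toL2_eq {f g : TestAlgebra d} (h : scalar f f = scalar g g) :
    ‖toL2 f‖ = ‖toL2 g‖ := by
  rw [← inner_toL2, ← inner_toL2, inner_self_eq_norm_sq_to_K, inner_self_eq_norm_sq_to_K] at h
  have h2 : ‖toL2 f‖ ^ 2 = ‖toL2 g‖ ^ 2 := by exact_mod_cast h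
  exact (sq_eq_sq₀ (norm_nonneg _) (norm_nonneg _)).1 h2

theorem eq_zero_of_scalar_self {f : TestAlgebra d} (h : scalar f f = 0) : f = 0 := by
  rw [← inner_toL2, inner_self_eq_zero] at h
  exact toL2_injective (h.trans (map_zero _).symm)

/-- `∫ p q` only depends on the product `p q`. -/
theorem pairing_congr {p q p' q' : TestAlgebra d} (h : p * q = p' * q') :
    pairing p q = pairing p' q' := by
  have key : ∀ p q : TestAlgebra d, pairing p q = ∫ x, (p * q) x := fun p q => by
    rw [pairing_apply]
    apply integral_congr_ae
    filter_upwards [coe_mul p q] with x hx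
    rw [hx]
  rw [key, key, h]

theorem exists_norm_toL2_mul_le (k : TestAlgebra d) :
    ∃ C : ℝ, 0 ≤ C ∧ ∀ f : TestAlgebra d, ‖toL2 (f * k)‖ ≤ C * ‖toL2 f‖ := by
  obtain ⟨C, hC, h⟩ := exists_ae_norm_le k
  refine ⟨C, hC, fun f => Lp.norm_le_mul_norm_of_ae_le_mul ?_⟩
  filter_upwards [h, coe_mul f k] with x h1 h2
  rw [coe_toL2, coe_toL2, h2, norm_mul, mul_comm]
  gcongr

theorem norm_toL2_star (f : TestAlgebra d) : ‖toL2 (star f)‖ = ‖toL2 f‖ := by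
  refine norm_toL2_eq ?_
  rw [← pairing_star, ← pairing_star, star_star]
  exact pairing_comm _ _

theorem tendsto_toL2_mul {u : ℕ → TestAlgebra d} {f : TestAlgebra d}
    (h : Filter.Tendsto (fun n => toL2 (u n)) Filter.atTop (nhds (toL2 f)))
    (k : TestAlgebra d) :
    Filter.Tendsto (fun n => toL2 (u n * k)) Filter.atTop (nhds (toL2 (f * k))) := by
  obtain ⟨C, -, hC⟩ := exists_norm_toL2_mul_le k
  rw [tendsto_iff_norm_sub_tendsto_zero] at h ⊢
  refine squeeze_zero (fun _ => norm_nonneg _) (fun n => ?_) (by simpa using h.const_mul C)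
  rw [← map_sub, ← sub_mul, ← map_sub]
  exact hC _

theorem tendsto_toL2_star {u : ℕ → TestAlgebra d} {f : TestAlgebra d}
    (h : Filter.Tendsto (fun n => toL2 (u n)) Filter.atTop (nhds (toL2 f))) :
    Filter.Tendsto (fun n => toL2 (star (u n))) Filter.atTop (nhds (toL2 (star f))) := by
  rw [tendsto_iff_norm_sub_tendsto_zero] at h ⊢
  convert h using 2
  rw [← map_sub, ← star_sub, norm_toL2_star, map_sub]

theorem tendsto_toL2_map {S : TestAlgebra d →ₗ[ℂ] TestAlgebra d}
    (hS : ∀ f g, scalar (S f) (S g) = scalar f g) {u : ℕ → TestAlgebra d} {f : TestAlgebra d}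
    (h : Filter.Tendsto (fun n => toL2 (u n)) Filter.atTop (nhds (toL2 f))) :
    Filter.Tendsto (fun n => toL2 (S (u n))) Filter.atTop (nhds (toL2 (S f))) := by
  rw [tendsto_iff_norm_sub_tendsto_zero] at h ⊢
  convert h using 2
  rw [← map_sub, ← map_sub, ← map_sub]
  exact norm_toL2_eq (hS _ _)

/-- The indicator function of a measurable set of finite measure. -/
def indicator (s : Set (EuclideanSpace ℝ (Fin d))) (hs : MeasurableSet s)
    (hs' : volume s ≠ ∞) : TestAlgebra d :=
  ⟨AEEqFun.mk (s.indicator fun _ => 1) (measurable_const.indicator hs).aestronglyMeasurable,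
    (memLp_congr_ae (AEEqFun.coeFn_mk _ _)).2 (memLp_indicator_const 2 hs 1 (Or.inr hs')),
    (memLp_congr_ae (AEEqFun.coeFn_mk _ _)).2 (memLp_indicator_const ∞ hs 1 (Or.inr hs'))⟩

theorem coe_indicator (s : Set (EuclideanSpace ℝ (Fin d))) (hs : MeasurableSet s)
    (hs' : volume s ≠ ∞) :
    ⇑(indicator s hs hs').toAEEqFun =ᵐ[volume] s.indicator fun _ => 1 :=
  AEEqFun.coeFn_mk _ _

/-- The indicator function of the ball of radius `n`. -/
def ballIndicator (d n : ℕ) : TestAlgebra d :=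
  indicator (Metric.closedBall 0 n) measurableSet_closedBall measure_closedBall_lt_top.ne

theorem coe_ballIndicator (n : ℕ) :
    ⇑(ballIndicator d n).toAEEqFun =ᵐ[volume]
      (Metric.closedBall (0 : EuclideanSpace ℝ (Fin d)) n).indicator fun _ => 1 :=
  coe_indicator _ _ _

theorem star_ballIndicator (n : ℕ) : star (ballIndicator d n) = ballIndicator d n := by
  apply ext
  filter_upwards [coe_star (ballIndicator d n), coe_ballIndicator (d := d) n] with x h1 h2
  rw [h1, h2]
  by_cases h : x ∈ Metric.closedBall (0 : EuclideanSpace ℝ (Fin d)) n <;> simp [h]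

theorem ballIndicator_mul {n m : ℕ} (hnm : n ≤ m) :
    ballIndicator d n * ballIndicator d m = ballIndicator d n := by
  apply ext
  filter_upwards [coe_mul (ballIndicator d n) (ballIndicator d m), coe_ballIndicator (d := d) n,
    coe_ballIndicator (d := d) m] with x h1 h2 h3
  rw [h1, h2, h3]
  by_cases h : x ∈ Metric.closedBall (0 : EuclideanSpace ℝ (Fin d)) n
  · have h' : x ∈ Metric.closedBall (0 : EuclideanSpace ℝ (Fin d)) m :=
      Metric.closedBall_subset_closedBall (by exact_mod_cast hnm) h
    rw [Set.indicator_of_mem h, Set.indicator_of_mem h', mul_one]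
  · rw [Set.indicator_of_notMem h, zero_mul]

theorem tendsto_mul_ballIndicator (f : TestAlgebra d) :
    Filter.Tendsto (fun n => toL2 (f * ballIndicator d n)) Filter.atTop (nhds (toL2 f)) := by
  have hsq : ∀ g : TestAlgebra d, ‖toL2 g‖ ^ 2 = ∫ x, ‖g x‖ ^ 2 := fun g => by
    have h1 := inner_self_eq_norm_sq_to_K (𝕜 := ℂ) (toL2 g)
    rw [inner_toL2, scalar] at h1
    have h2 : (∫ x, conj (g x) * g x) = ((∫ x, ‖g x‖ ^ 2 : ℝ) : ℂ) := by
      rw [← integral_complex_ofReal]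
      congr 1
      ext x
      rw [Complex.conj_mul', Complex.ofReal_pow]
    rw [h2] at h1
    refine Complex.ofReal_injective ?_
    rw [h1]
    push_cast
    rfl
  have key : Filter.Tendsto (fun n => ∫ x, ‖(f * ballIndicator d n - f) x‖ ^ 2) Filter.atTop
      (nhds (∫ _ : EuclideanSpace ℝ (Fin d), (0 : ℝ))) := by
    have hcoe : ∀ n, ∀ᵐ x : EuclideanSpace ℝ (Fin d), (f * ballIndicator d n - f) x =
        f x * (Metric.closedBall (0 : EuclideanSpace ℝ (Fin d)) n).indicator (fun _ => 1) x -
          f x := fun n => by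
      filter_upwards [AEEqFun.coeFn_sub (f * ballIndicator d n).toAEEqFun f.toAEEqFun,
        coe_mul f (ballIndicator d n), coe_ballIndicator (d := d) n] with x h1 h2 h3
      refine h1.trans ?_
      rw [Pi.sub_apply, h2, h3]
    refine tendsto_integral_of_dominated_convergence (fun x => ‖f x‖ ^ 2) (fun n => ?_) ?_
      (fun n => ?_) ?_
    · exact ((memLp_two _).1.norm.pow 2)
    · exact f.memLp_two.integrable_norm_pow two_ne_zero
    · filter_upwards [hcoe n] with x hx
      rw [hx, norm_pow, norm_norm]
      by_cases h : x ∈ Metric.closedBall (0 : EuclideanSpace ℝ (Fin d)) n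
      · simp [Set.indicator_of_mem h]
      · simp [Set.indicator_of_notMem h]
    · filter_upwards [ae_all_iff.2 hcoe] with x hx
      obtain ⟨N, hN⟩ := exists_nat_ge ‖x‖
      refine tendsto_const_nhds.congr' ?_
      filter_upwards [Filter.eventually_ge_atTop N] with n hn
      have h : x ∈ Metric.closedBall (0 : EuclideanSpace ℝ (Fin d)) n := by
        rw [mem_closedBall_zero_iff]
        exact hN.trans (by exact_mod_cast hn)
      rw [hx, Set.indicator_of_mem h]
      simp
  rw [integral_zero] at key
  rw [tendsto_iff_norm_sub_tendsto_zero]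
  have h2 := key.sqrt
  rw [Real.sqrt_zero] at h2
  refine h2.congr fun n => ?_
  rw [← hsq, Real.sqrt_sq (norm_nonneg _), map_sub]

/-- The class of the function `e^{iα}`. -/
def phase (α : EuclideanSpace ℝ (Fin d) → ℝ) (hα : Measurable α) :
    EuclideanSpace ℝ (Fin d) →ₘ[volume] ℂ :=
  AEEqFun.mk (fun x => Complex.exp (Complex.I * α x))
    (show Measurable fun x => Complex.exp (Complex.I * α x) by fun_prop).aestronglyMeasurable

theorem coe_phase_mul (α : EuclideanSpace ℝ (Fin d) → ℝ) (hα : Measurable α)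
    (f : EuclideanSpace ℝ (Fin d) →ₘ[volume] ℂ) :
    ⇑(phase α hα * f : EuclideanSpace ℝ (Fin d) →ₘ[volume] ℂ) =ᵐ[volume]
      fun x => Complex.exp (Complex.I * α x) * f x := by
  have hm : Measurable fun x => Complex.exp (Complex.I * α x) := by fun_prop
  filter_upwards [AEEqFun.coeFn_mul (phase α hα) f, AEEqFun.coeFn_mk _ hm.aestronglyMeasurable]
    with x h1 h2
  rw [h1, Pi.mul_apply, phase, h2]

/-- Multiplication by the phase `e^{iα}`. -/
def phaseMul (α : EuclideanSpace ℝ (Fin d) → ℝ) (hα : Measurable α) :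
    TestAlgebra d →ₗ[ℂ] TestAlgebra d :=
  have hn : ∀ f : TestAlgebra d, ∀ᵐ x : EuclideanSpace ℝ (Fin d),
      ‖(phase α hα * f.toAEEqFun : EuclideanSpace ℝ (Fin d) →ₘ[volume] ℂ) x‖ ≤ ‖f x‖ := fun f => by
    filter_upwards [coe_phase_mul α hα f.toAEEqFun] with x hx
    rw [hx, norm_mul, mul_comm Complex.I, Complex.norm_exp_ofReal_mul_I, one_mul]
  { toFun := fun f => ⟨phase α hα * f.toAEEqFun, f.memLp_two.of_le (AEEqFun.aestronglyMeasurable _) (hn f),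
      f.memLp_top.of_le (AEEqFun.aestronglyMeasurable _) (hn f)⟩
    map_add' := fun f g => by
      apply ext
      refine (coe_phase_mul α hα (f + g).toAEEqFun).trans (Filter.EventuallyEq.trans ?_
        (coe_add _ _).symm)
      filter_upwards [coe_add f g, coe_phase_mul α hα f.toAEEqFun,
        coe_phase_mul α hα g.toAEEqFun] with x h1 h2 h3
      rw [h1, mul_add, ← h2, ← h3]
      rfl
    map_smul' := fun z f => by
      apply ext
      refine (coe_phase_mul α hα (z • f).toAEEqFun).trans (Filter.EventuallyEq.trans ?_
        (coe_smul _ _).symm)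
      filter_upwards [coe_smul z f, coe_phase_mul α hα f.toAEEqFun] with x h1 h2
      rw [h1, mul_left_comm, ← h2]
      rfl }

theorem coe_phaseMul (α : EuclideanSpace ℝ (Fin d) → ℝ) (hα : Measurable α) (f : TestAlgebra d) :
    ⇑(phaseMul α hα f).toAEEqFun =ᵐ[volume] fun x => Complex.exp (Complex.I * α x) * f x :=
  coe_phase_mul α hα f.toAEEqFun

end TestAlgebra

/-! ### Moment-preserving maps are triple homomorphisms -/

section Triple

open TestAlgebra

variable {d : ℕ} {T : TestAlgebra d →ₗ[ℂ] TestAlgebra d}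

/-- Polarization of a square. -/
theorem polarize_sq {ℓ ℓ' : TestAlgebra d →ₗ[ℂ] ℂ}
    (h : ∀ f, ℓ (T f * T f) = ℓ' (f * f)) (a b : TestAlgebra d) :
    ℓ (T a * T b) = ℓ' (a * b) := by
  have key : ∀ x y : TestAlgebra d, (2 : ℂ) • (x * y) = (x + y) * (x + y) - x * x - y * y := by
    intro x y
    simp only [add_mul, mul_add, mul_comm y x]
    module
  refine mul_left_cancel₀ (two_ne_zero (α := ℂ)) ?_
  have hs : ∀ (ℓ : TestAlgebra d →ₗ[ℂ] ℂ) (z : ℂ) x, z * ℓ x = ℓ (z • x) := fun ℓ z x => by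
    rw [map_smul, smul_eq_mul]
  rw [hs, hs, key, key]
  simp only [map_sub, ← h, map_add]

/-- Polarization of a cube. -/
theorem polarize_cube {ℓ ℓ' : TestAlgebra d →ₗ[ℂ] ℂ}
    (h : ∀ f, ℓ (T f * T f * T f) = ℓ' (f * f * f)) (a b e : TestAlgebra d) :
    ℓ (T a * T b * T e) = ℓ' (a * b * e) := by
  have key : ∀ x y z : TestAlgebra d, (6 : ℂ) • (x * y * z) =
      (x + y + z) * (x + y + z) * (x + y + z) - (x + y) * (x + y) * (x + y) -
        (x + z) * (x + z) * (x + z) - (y + z) * (y + z) * (y + z) +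
        x * x * x + y * y * y + z * z * z := by
    intro x y z
    simp only [mul_add, mul_comm, mul_left_comm]
    module
  refine mul_left_cancel₀ (show (6 : ℂ) ≠ 0 by norm_num) ?_
  have hs : ∀ (ℓ : TestAlgebra d →ₗ[ℂ] ℂ) (z : ℂ) x, z * ℓ x = ℓ (z • x) := fun ℓ z x => by
    rw [map_smul, smul_eq_mul]
  rw [hs, hs, key, key]
  simp only [map_sub, map_add, ← h]

theorem pairing_star_right (p q : TestAlgebra d) : pairing (star p) q = conj (pairing p (star q)) := by
  rw [← RCLike.star_def, star_pairing, star_star]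

theorem scalar_map_of_moment (h : ∀ k f g, moment k (T f) (T g) = moment k f g)
    (f g : TestAlgebra d) : scalar (T f) (T g) = scalar f g := by
  have := h 0 f g
  rwa [moment, moment, Function.iterate_zero_apply, Function.iterate_zero_apply, pairing_star,
    pairing_star] at this

theorem pairing_map_mul₂ (h : ∀ k f g, moment k (T f) (T g) = moment k f g)
    (a b a' b' : TestAlgebra d) :
    pairing (star (T a * T b)) (T a' * T b') = pairing (star (a * b)) (a' * b') := by
  have h1 : ∀ f g : TestAlgebra d, moment 1 f g = pairing (star (f * f)) (g * g) := fun f g =>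
    pairing_congr (by
      simp only [Function.iterate_one, star_mul', mul_comm, mul_left_comm, mul_assoc])
  have h2 : ∀ f a b : TestAlgebra d,
      pairing (star (T f * T f)) (T a * T b) = pairing (star (f * f)) (a * b) := fun f =>
    polarize_sq fun g => by rw [← h1, ← h1, h]
  rw [pairing_star_right, pairing_star_right (a * b), pairing_comm (T a * T b),
    pairing_comm (a * b)]
  refine congrArg conj (polarize_sq (fun f => ?_) a b)
  have h3 := congrArg conj (h2 f a' b')
  rwa [pairing_star_right, pairing_star_right (f * f), Complex.conj_conj, Complex.conj_conj,
    pairing_comm, pairing_comm (f * f)] at h3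

theorem pairing_map_mul₃ (h : ∀ k f g, moment k (T f) (T g) = moment k f g)
    (a b e a' b' e' : TestAlgebra d) :
    pairing (star (T a * T b * T e)) (T a' * T b' * T e') =
      pairing (star (a * b * e)) (a' * b' * e') := by
  have h1 : ∀ f g : TestAlgebra d, moment 2 f g = pairing (star (f * f * f)) (g * g * g) :=
    fun f g => pairing_congr (by
      simp only [Function.iterate_succ_apply, Function.iterate_zero_apply, star_mul', mul_comm,
        mul_left_comm, mul_assoc])
  have h2 : ∀ f a b e : TestAlgebra d,
      pairing (star (T f * T f * T f)) (T a * T b * T e) =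
        pairing (star (f * f * f)) (a * b * e) := fun f =>
    polarize_cube fun g => by rw [← h1, ← h1, h]
  rw [pairing_star_right, pairing_star_right (a * b * e), pairing_comm (T a * T b * T e),
    pairing_comm (a * b * e)]
  refine congrArg conj (polarize_cube (fun f => ?_) a b e)
  have h3 := congrArg conj (h2 f a' b' e')
  rwa [pairing_star_right, pairing_star_right (f * f * f), Complex.conj_conj, Complex.conj_conj,
    pairing_comm, pairing_comm (f * f * f)] at h3

/-- Expanding `‖T (f \bar g k) - T f \overline{T g} T k‖²`, each of the four terms is `± ‖f g k‖²`
by the polarized moment identities. -/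
theorem map_triple (h : ∀ k f g, moment k (T f) (T g) = moment k f g) (f g k : TestAlgebra d) :
    T (f * star g * k) = T f * star (T g) * T k := by
  set a := f * star g * k with ha
  set b := T f * star (T g) * T k with hb
  have h1 : pairing (star (T a)) (T a) = pairing (star a) a := by
    rw [pairing_star, pairing_star, scalar_map_of_moment h]
  have h2 : pairing (star (T a)) b = pairing (star a) a := by
    rw [pairing_congr (q := b) (p' := star (T a * T g)) (q' := T f * T k), pairing_map_mul₂ h]
    · apply pairing_congr
      simp only [ha, star_mul', star_star, mul_comm, mul_left_comm, mul_assoc]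
    · simp only [hb, star_mul', mul_comm, mul_left_comm, mul_assoc]
  have h3 : pairing (star b) (T a) = pairing (star a) a := by
    have := congrArg conj h2
    rwa [pairing_star_right, pairing_star_right a, Complex.conj_conj, Complex.conj_conj,
      pairing_comm, pairing_comm a] at this
  have h4 : pairing (star b) b = pairing (star a) a := by
    rw [pairing_congr (p := star b) (q := b) (p' := star (T f * T g * T k))
      (q' := T f * T g * T k), pairing_map_mul₃ h]
    · apply pairing_congr
      simp only [ha, star_mul', star_star, mul_comm, mul_left_comm, mul_assoc]
    · simp only [hb, star_mul', star_star, mul_comm, mul_left_comm, mul_assoc]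
  rw [← sub_eq_zero]
  apply eq_zero_of_scalar_self
  rw [← pairing_star, star_sub]
  simp only [map_sub, LinearMap.sub_apply, h1, h2, h3, h4, sub_self]

end Triple

/-! ### Splitting off the phase of a moment-preserving map -/

section Phase

open TestAlgebra

variable {d : ℕ} {T : TestAlgebra d →ₗ[ℂ] TestAlgebra d}

theorem conj_exp_mul_exp (a : ℝ) :
    conj (Complex.exp (Complex.I * a)) * Complex.exp (Complex.I * a) = 1 := by
  rw [Complex.conj_mul', mul_comm, Complex.norm_exp_ofReal_mul_I]
  simp

theorem scalar_phaseMul (α : EuclideanSpace ℝ (Fin d) → ℝ) (hα : Measurable α)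
    (f g : TestAlgebra d) : scalar (phaseMul α hα f) (phaseMul α hα g) = scalar f g := by
  rw [scalar, scalar]
  apply integral_congr_ae
  filter_upwards [coe_phaseMul α hα f, coe_phaseMul α hα g] with x h1 h2
  rw [h1, h2, map_mul, mul_mul_mul_comm, conj_exp_mul_exp, one_mul]

theorem phaseMul_neg (α : EuclideanSpace ℝ (Fin d) → ℝ) (hα : Measurable α) (f : TestAlgebra d) :
    phaseMul (-α) hα.neg (phaseMul α hα f) = f := by
  apply ext
  filter_upwards [coe_phaseMul (-α) hα.neg (phaseMul α hα f), coe_phaseMul α hα f] with x h1 h2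
  rw [h1, h2, ← mul_assoc, ← Complex.exp_add]
  simp

/-- The images of the indicator functions of balls have absolute values `0` and `1`, and they
extend each other, since `T e = T e \overline{T e} T e'` for `e ≤ e'`; so they have a common
phase. -/
theorem exists_common_phase (h : ∀ k f g, moment k (T f) (T g) = moment k f g) :
    ∃ α : EuclideanSpace ℝ (Fin d) → ℝ, Measurable α ∧ ∀ᵐ x : EuclideanSpace ℝ (Fin d), ∀ n,
      T (ballIndicator d n) x = 0 ∨ T (ballIndicator d n) x = Complex.exp (Complex.I * α x) := by
  -- Almost everywhere the arguments are eventually constant; `limsup` is a measurable way to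
  -- select their limit.
  refine ⟨fun x => Filter.limsup (fun n => Complex.arg (T (ballIndicator d n) x)) Filter.atTop,
    Measurable.limsup fun n => Complex.measurable_arg.comp (AEEqFun.measurable _), ?_⟩
  have hrel : ∀ n m, n ≤ m → ∀ᵐ x : EuclideanSpace ℝ (Fin d), T (ballIndicator d n) x =
      T (ballIndicator d n) x * conj (T (ballIndicator d n) x) * T (ballIndicator d m) x := by
    intro n m hnm
    have h1 := map_triple h (ballIndicator d n) (ballIndicator d n) (ballIndicator d m)
    rw [star_ballIndicator, ballIndicator_mul le_rfl, ballIndicator_mul hnm] at h1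
    filter_upwards [coe_mul (T (ballIndicator d n) * star (T (ballIndicator d n)))
      (T (ballIndicator d m)), coe_mul (T (ballIndicator d n)) (star (T (ballIndicator d n))),
      coe_star (T (ballIndicator d n))] with x h2 h3 h4
    rw [← h1, h3, h4] at h2
    exact h2
  have hrel' : ∀ᵐ x : EuclideanSpace ℝ (Fin d), ∀ n m, n ≤ m → T (ballIndicator d n) x =
      T (ballIndicator d n) x * conj (T (ballIndicator d n) x) * T (ballIndicator d m) x := by
    simp only [ae_all_iff]
    exact hrel
  filter_upwards [hrel'] with x hx n
  refine or_iff_not_imp_left.2 fun hne => ?_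
  have h1 : conj (T (ballIndicator d n) x) * T (ballIndicator d n) x = 1 := by
    have := hx n n le_rfl
    rw [mul_assoc] at this
    exact (mul_eq_left₀ hne).1 this.symm
  have h2 : ∀ m, n ≤ m → T (ballIndicator d m) x = T (ballIndicator d n) x := fun m hm => by
    rw [hx n m hm, mul_comm (T (ballIndicator d n) x), h1, one_mul]
  have h3 : Filter.limsup (fun m => Complex.arg (T (ballIndicator d m) x)) Filter.atTop =
      Complex.arg (T (ballIndicator d n) x) := by
    refine Filter.Tendsto.limsup_eq (tendsto_const_nhds.congr' ?_)
    filter_upwards [Filter.eventually_ge_atTop n] with m hm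
    rw [h2 m hm]
  have h4 : ‖T (ballIndicator d n) x‖ = 1 := by
    rw [Complex.conj_mul'] at h1
    have h5 : ‖T (ballIndicator d n) x‖ ^ 2 = 1 := by exact_mod_cast h1
    exact (pow_eq_one_iff_of_nonneg (norm_nonneg _) two_ne_zero).1 h5
  have h5 := Complex.norm_mul_exp_arg_mul_I (T (ballIndicator d n) x)
  rw [h4, Complex.ofReal_one, one_mul] at h5
  rw [h3, mul_comm, h5]

/-- The triple homomorphism property gives multiplicativity and compatibility with the conjugation
on the ideals of functions supported in balls; these properties extend by `L²`-continuity. -/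
theorem exists_isStarEndomorphism (h : ∀ k f g, moment k (T f) (T g) = moment k f g) :
    ∃ (α : EuclideanSpace ℝ (Fin d) → ℝ) (hα : Measurable α),
      IsStarEndomorphism (phaseMul (-α) hα.neg ∘ₗ T) ∧
        IsPhaseMultiple α T (phaseMul (-α) hα.neg ∘ₗ T) := by
  obtain ⟨α, hα, hphase⟩ := exists_common_phase h
  refine ⟨α, hα, ?_, fun f => ?_⟩
  swap
  · filter_upwards [coe_phaseMul (-α) hα.neg (T f)] with x hx
    rw [LinearMap.comp_apply, hx, ← mul_assoc, ← Complex.exp_add]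
    simp
  set S := phaseMul (-α) hα.neg ∘ₗ T with hS
  have hScoe : ∀ f : TestAlgebra d, ∀ᵐ x : EuclideanSpace ℝ (Fin d),
      S f x = conj (Complex.exp (Complex.I * α x)) * T f x := fun f => by
    filter_upwards [coe_phaseMul (-α) hα.neg (T f)] with x hx
    rw [hS, LinearMap.comp_apply, hx, ← Complex.exp_conj]
    simp
  have hscalar : ∀ f g, scalar (S f) (S g) = scalar f g := fun f g => by
    rw [hS, LinearMap.comp_apply, LinearMap.comp_apply, scalar_phaseMul, scalar_map_of_moment h]
  have htriple : ∀ f g k : TestAlgebra d, ∀ᵐ x : EuclideanSpace ℝ (Fin d),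
      T (f * star g * k) x = T f x * conj (T g x) * T k x := fun f g k => by
    filter_upwards [coe_mul (T f * star (T g)) (T k), coe_mul (T f) (star (T g)),
      coe_star (T g)] with x h1 h2 h3
    rw [map_triple h, h1, h2, h3]
  have hlocal : ∀ f n, ∀ᵐ x : EuclideanSpace ℝ (Fin d), S (f * ballIndicator d n) x =
      conj (Complex.exp (Complex.I * α x)) *
        (T f x * conj (T (ballIndicator d n) x) * T (ballIndicator d n) x) := fun f n => by
    have h1 : f * star (ballIndicator d n) * ballIndicator d n = f * ballIndicator d n := by
      rw [star_ballIndicator, mul_assoc, ballIndicator_mul le_rfl]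
    filter_upwards [hScoe (f * ballIndicator d n),
      htriple f (ballIndicator d n) (ballIndicator d n)] with x h2 h3
    rw [h2, ← h3, h1]
  have hmul : ∀ f k n, S (f * ballIndicator d n * k) = S (f * ballIndicator d n) * S k := by
    intro f k n
    have h1 : f * star (ballIndicator d n) * k = f * ballIndicator d n * k := by
      rw [star_ballIndicator]
    apply ext
    filter_upwards [hScoe (f * ballIndicator d n * k), htriple f (ballIndicator d n) k,
      hlocal f n, coe_mul (S (f * ballIndicator d n)) (S k), hScoe k, hphase]
      with x h2 h3 h4 h5 h6 h7
    rw [h2, ← h1, h3, h5, h4, h6]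
    rcases h7 n with h8 | h8
    · simp [h8]
    · rw [h8]
      linear_combination -(conj (Complex.exp (Complex.I * α x)) ^ 2 * T f x * T k x) *
        conj_exp_mul_exp (α x)
  have hstar : ∀ f n, S (star f * ballIndicator d n) = star (S (f * ballIndicator d n)) := by
    intro f n
    have h1 : ballIndicator d n * star f * ballIndicator d n = star f * ballIndicator d n := by
      rw [mul_comm (ballIndicator d n), mul_assoc, ballIndicator_mul le_rfl]
    apply ext
    filter_upwards [hScoe (star f * ballIndicator d n),
      htriple (ballIndicator d n) f (ballIndicator d n), hlocal f n,
      coe_star (S (f * ballIndicator d n)), hphase] with x h2 h3 h4 h5 h6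
    rw [h2, ← h1, h3, h5, h4]
    rcases h6 n with h7 | h7
    · simp [h7]
    · rw [h7]
      simp only [map_mul, Complex.conj_conj]
      ring
  refine ⟨hscalar, fun f g => ?_, fun f => ?_⟩
  · have h1 := tendsto_toL2_map hscalar (tendsto_toL2_mul (tendsto_mul_ballIndicator f) g)
    have h2 := tendsto_toL2_mul (tendsto_toL2_map hscalar (tendsto_mul_ballIndicator f)) (S g)
    simp only [hmul] at h1
    exact toL2_injective (tendsto_nhds_unique h1 h2)
  · have h1 := tendsto_toL2_map hscalar (tendsto_mul_ballIndicator (star f))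
    have h2 := tendsto_toL2_star (tendsto_toL2_map hscalar (tendsto_mul_ballIndicator f))
    simp only [hstar] at h1
    exact toL2_injective (tendsto_nhds_unique h1 h2)

theorem moment_of_isPhaseMultiple {α : EuclideanSpace ℝ (Fin d) → ℝ}
    {T₁ : TestAlgebra d →ₗ[ℂ] TestAlgebra d} (h₁ : IsStarEndomorphism T₁)
    (h : IsPhaseMultiple α T T₁) (k : ℕ) (f g : TestAlgebra d) :
    moment k (T f) (T g) = moment k f g := by
  have hiter : ∀ f : TestAlgebra d, (fun x => T₁ f * x)^[k] (T₁ f) = T₁ ((fun x => f * x)^[k] f) := by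
    intro f
    induction k with
    | zero => rfl
    | succ k ih => rw [Function.iterate_succ_apply', ih, Function.iterate_succ_apply', h₁.map_mul]
  have h1 : moment k (T f) (T g) = moment k (T₁ f) (T₁ g) := by
    rw [moment_eq_integral, moment_eq_integral]
    apply integral_congr_ae
    filter_upwards [h f, h g] with x h2 h3
    rw [h2, h3, map_mul, mul_mul_mul_comm, conj_exp_mul_exp, one_mul]
  rw [h1, moment, moment, VacuumModule.pairing_iterate, VacuumModule.pairing_iterate, hiter, hiter,
    pairing_star, pairing_star, h₁.scalar_map]

end Phase

/-! ### Surjectivity -/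

section Surjective

open TestAlgebra

variable {d : ℕ}

/-- If `S uₙ → g` in `L²`, then `uₙ` converges to some `φ` in `L²`, and
`‖φ k‖ = ‖g S k‖ ≤ C ‖k‖` for all indicator functions `k`, where `C` bounds `g`; so `C` bounds
`φ`. -/
theorem exists_map_eq_of_tendsto {S : TestAlgebra d →ₗ[ℂ] TestAlgebra d}
    (hS : IsStarEndomorphism S) {u : ℕ → TestAlgebra d} {g : TestAlgebra d}
    (hu : Filter.Tendsto (fun n => toL2 (S (u n))) Filter.atTop (nhds (toL2 g))) :
    ∃ f, S f = g := by
  have hnorm : ∀ f, ‖toL2 (S f)‖ = ‖toL2 f‖ := fun f => norm_toL2_eq (hS.scalar_map f f)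
  have hcauchy : CauchySeq fun n => toL2 (u n) := by
    have h1 := hu.cauchySeq
    rw [Metric.cauchySeq_iff] at h1 ⊢
    intro ε hε
    obtain ⟨N, hN⟩ := h1 ε hε
    refine ⟨N, fun m hm n hn => ?_⟩
    have h2 := hN m hm n hn
    rwa [dist_eq_norm, ← map_sub, ← map_sub, hnorm, map_sub, ← dist_eq_norm] at h2
  obtain ⟨φ, hφ⟩ := cauchySeq_tendsto_of_complete hcauchy
  obtain ⟨C, hC, hCg⟩ := exists_norm_toL2_mul_le g
  have hset : ∀ s, MeasurableSet s → volume s < ∞ →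
      eLpNorm φ 2 (volume.restrict s) ≤ ENNReal.ofReal C * volume s ^ (1 / (2 : ℝ)) := by
    intro s hs hs'
    set k := indicator s hs hs'.ne with hk
    have hkn : ‖toL2 k‖ₑ = volume s ^ (1 / (2 : ℝ)) := by
      rw [Lp.enorm_def, coe_toL2, eLpNorm_congr_ae (coe_indicator s hs hs'.ne),
        eLpNorm_indicator_const hs two_ne_zero (by simp)]
      simp
    have hlim : Filter.Tendsto (fun n => ‖toL2 (u n * k)‖) Filter.atTop
        (nhds ‖toL2 (g * S k)‖) := by
      have h1 := (tendsto_toL2_mul hu (S k)).norm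
      refine h1.congr fun n => ?_
      rw [← hS.map_mul, hnorm]
    have hres : ∀ n, ‖LpToLpRestrictCLM _ ℂ ℂ volume 2 s (toL2 (u n))‖ = ‖toL2 (u n * k)‖ := by
      intro n
      rw [Lp.norm_def, Lp.norm_def, eLpNorm_congr_ae (LpToLpRestrictCLM_coeFn ℂ s (toL2 (u n))),
        coe_toL2, coe_toL2, ← eLpNorm_indicator_eq_eLpNorm_restrict hs]
      congr 1
      apply eLpNorm_congr_ae
      filter_upwards [coe_mul (u n) k, coe_indicator s hs hs'.ne] with x h1 h2
      rw [h1, hk, h2]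
      by_cases hx : x ∈ s <;> simp [hx]
    have hlim' := (((LpToLpRestrictCLM _ ℂ ℂ volume 2 s).continuous.tendsto φ).comp hφ).norm
    simp only [Function.comp_apply, hres] at hlim'
    have h1 : ‖LpToLpRestrictCLM _ ℂ ℂ volume 2 s φ‖ ≤ C * ‖toL2 k‖ := by
      rw [tendsto_nhds_unique hlim' hlim, mul_comm g, ← hnorm k]
      exact hCg (S k)
    have h2 : ‖LpToLpRestrictCLM _ ℂ ℂ volume 2 s φ‖ₑ ≤ ENNReal.ofReal C * ‖toL2 k‖ₑ := by
      rw [← ofReal_norm, ← ofReal_norm, ← ENNReal.ofReal_mul hC]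
      exact ENNReal.ofReal_le_ofReal h1
    rwa [Lp.enorm_def, eLpNorm_congr_ae (LpToLpRestrictCLM_coeFn ℂ s φ), hkn] at h2
  have hbound : ∀ᵐ x : EuclideanSpace ℝ (Fin d), ‖φ x‖ ≤ C := by
    have h1 : (fun x => ‖φ x‖ₑ ^ (2 : ℝ)) ≤ᵐ[volume] fun _ => ENNReal.ofReal C ^ (2 : ℝ) := by
      refine ae_le_of_forall_setLIntegral_le_of_sigmaFinite₀
        ((Lp.aestronglyMeasurable φ).enorm.pow_const _) fun s hs hs' => ?_
      have h2 := ENNReal.rpow_le_rpow (hset s hs hs') (zero_le_two (α := ℝ))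
      rw [ENNReal.mul_rpow_of_nonneg _ _ zero_le_two, ← ENNReal.rpow_mul] at h2
      have h3 := eLpNorm_nnreal_pow_eq_lintegral (f := φ) (μ := volume.restrict s)
        (p := 2) two_ne_zero
      simp only [ENNReal.coe_ofNat, NNReal.coe_ofNat] at h3
      rw [h3] at h2
      simpa using h2
    filter_upwards [h1] with x hx
    have h2 := (ENNReal.rpow_le_rpow_iff two_pos).1 hx
    rw [← ofReal_norm] at h2
    exact (ENNReal.ofReal_le_ofReal_iff hC).1 h2
  let f : TestAlgebra d := ⟨φ.1, Lp.memLp φ, memLp_top_of_bound (Lp.aestronglyMeasurable φ) C hbound⟩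
  exact ⟨f, toL2_injective (tendsto_nhds_unique
    (tendsto_toL2_map hS.scalar_map (f := f) hφ) hu)⟩

theorem surjective_of_isPhaseMultiple {α : EuclideanSpace ℝ (Fin d) → ℝ}
    {T T₁ : TestAlgebra d →ₗ[ℂ] TestAlgebra d} (hα : Measurable α) (h₁ : Function.Surjective T₁)
    (h : IsPhaseMultiple α T T₁) : Function.Surjective T := by
  intro g
  obtain ⟨f, hf⟩ := h₁ (phaseMul (-α) hα.neg g)
  refine ⟨f, ext ?_⟩
  filter_upwards [h f, coe_phaseMul (-α) hα.neg g] with x h1 h2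
  rw [h1, hf, h2, ← mul_assoc, ← Complex.exp_add]
  simp

/-- The one-particle vectors `B⁺_f Φ` form a multiple of the Hilbert space `L²`. -/
theorem norm_oneParticle (c : ℝ≥0) (f : TestAlgebra d) :
    ‖oneParticle c f‖ = √(2 * c) * ‖toL2 f‖ := by
  have h1 := inner_oneParticle (c := c) f f
  rw [← inner_toL2, inner_self_eq_norm_sq_to_K, inner_self_eq_norm_sq_to_K] at h1
  have h2 : ‖oneParticle c f‖ ^ 2 = 2 * c * ‖toL2 f‖ ^ 2 := by
    refine Complex.ofReal_injective ?_
    push_cast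
    exact h1
  rw [← Real.sqrt_sq (norm_nonneg (oneParticle c f)), h2, Real.sqrt_mul (by positivity),
    Real.sqrt_sq (norm_nonneg _)]

theorem surjective_of_unitary {c : ℝ≥0} (hc : 0 < c) {α : EuclideanSpace ℝ (Fin d) → ℝ}
    {T : TestAlgebra d →ₗ[ℂ] TestAlgebra d} (hα : Measurable α)
    (h₁ : IsStarEndomorphism (phaseMul (-α) hα.neg ∘ₗ T))
    {G : FockSpace c d →ₗ.[ℂ] FockSpace c d} (hG : IsSecondQuantization T G)
    (U : FockSpace c d ≃ₗᵢ[ℂ] FockSpace c d) (hU : ∀ x : G.domain, U x = G x) :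
    Function.Surjective (phaseMul (-α) hα.neg ∘ₗ T) := by
  intro g
  obtain ⟨v, hv, hlim⟩ := mem_closure_iff_seq_limit.1
    (oneParticle_mem_closure_of_unitary hG U hU (phaseMul α hα g))
  choose u hu using hv
  have hpos : 0 < √(2 * (c : ℝ)) := Real.sqrt_pos.2 (by positivity)
  have hL2 : Filter.Tendsto (fun n => toL2 (T (u n))) Filter.atTop
      (nhds (toL2 (phaseMul α hα g))) := by
    rw [tendsto_iff_norm_sub_tendsto_zero] at hlim ⊢
    have h1 := hlim.const_mul (√(2 * (c : ℝ)))⁻¹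
    rw [mul_zero] at h1
    refine h1.congr fun n => ?_
    rw [← hu n, ← map_sub, norm_oneParticle, ← map_sub, inv_mul_cancel_left₀ hpos.ne']
  have h2 := tendsto_toL2_map (scalar_phaseMul (-α) hα.neg) hL2
  rw [phaseMul_neg] at h2
  exact exists_map_eq_of_tendsto h₁ h2

end Surjective

end QuadraticFock

end

theorem theorem3 (c : ℝ≥0) (hc : 0 < c) (d : ℕ)
    (T : QuadraticFock.TestAlgebra d →ₗ[ℂ] QuadraticFock.TestAlgebra d) :
    (QuadraticFock.SecondQuantizationIsometric c T ↔
      ∃ (α : EuclideanSpace ℝ (Fin d) → ℝ)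
        (T₁ : QuadraticFock.TestAlgebra d →ₗ[ℂ] QuadraticFock.TestAlgebra d),
        Measurable α ∧ QuadraticFock.IsStarEndomorphism T₁ ∧
          QuadraticFock.IsPhaseMultiple α T T₁) ∧
    (QuadraticFock.SecondQuantizationUnitary c T ↔
      ∃ (α : EuclideanSpace ℝ (Fin d) → ℝ)
        (T₁ : QuadraticFock.TestAlgebra d →ₗ[ℂ] QuadraticFock.TestAlgebra d),
        Measurable α ∧ QuadraticFock.IsStarAutomorphism T₁ ∧
          QuadraticFock.IsPhaseMultiple α T T₁) := by
  refine ⟨?_, ⟨?_, ?_⟩⟩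
  · rw [QuadraticFock.secondQuantizationIsometric_iff_moment hc]
    constructor
    · intro h
      obtain ⟨α, hα, h₁, h₂⟩ := QuadraticFock.exists_isStarEndomorphism h
      exact ⟨α, _, hα, h₁, h₂⟩
    · rintro ⟨α, T₁, -, h₁, h₂⟩
      exact QuadraticFock.moment_of_isPhaseMultiple h₁ h₂
  · rintro ⟨G, hG, U, hU⟩
    have hiso : ∀ x : G.domain, ‖G x‖ = ‖(x : QuadraticFock.FockSpace c d)‖ := fun x => by
      rw [← hU, U.norm_map]
    obtain ⟨α, hα, h₁, h₂⟩ := QuadraticFock.exists_isStarEndomorphism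
      (QuadraticFock.moment_map_of_isometric hc hG hiso)
    exact ⟨α, _, hα, ⟨h₁, QuadraticFock.surjective_of_unitary hc hα h₁ hG U hU⟩, h₂⟩
  · rintro ⟨α, T₁, hα, h₁, h₂⟩
    exact QuadraticFock.secondQuantizationUnitary_of_surjective
      (QuadraticFock.surjective_of_isPhaseMultiple hα h₁.surjective h₂)
      (QuadraticFock.moment_of_isPhaseMultiple h₁.toIsStarEndomorphism h₂)
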